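/- Let $G$ be a locally compact second countable topological group equipped with a left-invariant proper metric $d$ that induces its topology, let $\mathcal H$ be a left Haar measure on $G$, and let $p\in(1,+\infty)$. Let $\pi$ be the right-regular representation of $G$ on $L^p(G)=L^p(G,\mathcal H)$, $(\pi(g)u)(x)=u(xg)$. For $k\in\mathbf N$ let $C^k(G,L^p(G))$ be the space of continuous maps $G^{k+1}\to L^p(G)$ with the compact-open topology, on which $G$ acts by $(g\cdot f)(x_0,\dots,x_k)=\pi(g)\bigl(f(g^{-1}x_0,\dots,g^{-1}x_k)\bigr)$, and let $C^k(G,L^p(G))^G$ be the subspace of invariant elements. Let $AS^{k,p}(G)$ be the space of classes (modulo almost everywhere equality) of measurable functions $u:G^{k+1}\to\mathbf R$ such that for every $s>0$ $$N_s(u)^p=\int_{\Delta_s^{(k)}}|u(x_0,\dots,x_k)|^p\,d\mathcal H(x_0)\cdots d\mathcal H(x_k)<\infty,\qquad \Delta_s^{(k)}=\{(x_0,\dots,x_k)\in G^{k+1} : d(x_i,x_j)\le s \text{ for all } i,j\},$$ with the topology defined by the semi-norms $N_s$, $s>0$. Both families form complexes with the differentials $(d_kf)(x_0,\dots,x_{k+1})=\sum_{i=0}^{k+1}(-1)^i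 f(x_0,\dots,\widehat{x_i},\dots,x_{k+1})$. Then the complexes $C^*(G,L^p(G))^G$ and $AS^{*,p}(G)$ are homotopy equivalent: there are continuous linear cochain maps $\varphi_*:C^*(G,L^p(G))^G\to AS^{*,p}(G)$ and $\psi_*:AS^{*,p}(G)\to C^*(G,L^p(G))^G$, and continuous linear maps $\alpha_*$, $\beta_*$ of degree $-1$ on the two complexes, with $d\alpha+\alpha d=\mathrm{id}-\psi\varphi$ and $d\beta+\beta d=\mathrm{id}-\varphi\psi$ in every degree (where $d_{-1}=\alpha_0=\beta_0=0$). In particular, for every $k\in\mathbf N$ there are isomorphisms of topological vector spaces $$\mathrm H^k_{\mathrm{ct}}(G,L^p(G))\simeq L^p\mathrm H^k_{AS}(G)\quad\text{and}\quad \overline{\mathrm H^k_{\mathrm{ct}}}(G,L^p(G))\simeq L^p\overline{\mathrm H^k_{AS}}(G),$$ where the spaces on the left (respectively right) are the cohomology $\operatorname{Ker}d_k/\operatorname{Im}d_{k-1}$ and the reduced cohomology $\operatorname{Ker}d_k/\overline{\operatorname{Im}d_{k-1}}$ of the complex $C^*(G,L^p(G))^G$ (respectively $AS^{*,p}(G)$),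 with the quotient topologies. -/

import Mathlib

open MeasureTheory Filter Topology
open scoped ENNReal NNReal

set_option linter.unusedSectionVars false

namespace LpCoh

universe u v

/-! ### Complexes of Hausdorff locally convex real vector spaces -/

/-- A cochain complex `A⁰ → A¹ → A² → ⋯` of Hausdorff locally convex topological vector spaces
over `ℝ`, with continuous linear differentials. -/
structure TopComplex where
  X : ℕ → Type u
  [addCommGroup : ∀ k, AddCommGroup (X k)]
  [module : ∀ k, Module ℝ (X k)]
  [topologicalSpace : ∀ k, TopologicalSpace (X k)]
  [isTopologicalAddGroup : ∀ k, IsTopologicalAddGroup (X k)]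
  [continuousSMul : ∀ k, ContinuousSMul ℝ (X k)]
  [locallyConvex : ∀ k, LocallyConvexSpace ℝ (X k)]
  [t2 : ∀ k, T2Space (X k)]
  d : ∀ k, X k →L[ℝ] X (k + 1)
  d_comp_d : ∀ k x, d (k + 1) (d k x) = 0

attribute [instance] TopComplex.addCommGroup TopComplex.module TopComplex.topologicalSpace
  TopComplex.isTopologicalAddGroup TopComplex.continuousSMul TopComplex.locallyConvex
  TopComplex.t2

namespace TopComplex

/-- A homotopy equivalence between two complexes: continuous linear cochain maps `φ`, `ψ` and
continuous linear homotopies `α`, `β` (lowering the degree by one) from `id` to `ψ ∘ φ` and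
from `id` to `φ ∘ ψ`. -/
structure HtpyEquiv (A : TopComplex.{u}) (B : TopComplex.{v}) where
  φ : ∀ k, A.X k →L[ℝ] B.X k
  ψ : ∀ k, B.X k →L[ℝ] A.X k
  α : ∀ k, A.X (k + 1) →L[ℝ] A.X k
  β : ∀ k, B.X (k + 1) →L[ℝ] B.X k
  φ_d : ∀ k x, φ (k + 1) (A.d k x) = B.d k (φ k x)
  ψ_d : ∀ k x, ψ (k + 1) (B.d k x) = A.d k (ψ k x)
  α_zero : ∀ x, α 0 (A.d 0 x) = x - ψ 0 (φ 0 x)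
  α_succ : ∀ k x, A.d k (α k x) + α (k + 1) (A.d (k + 1) x) = x - ψ (k + 1) (φ (k + 1) x)
  β_zero : ∀ x, β 0 (B.d 0 x) = x - φ 0 (ψ 0 x)
  β_succ : ∀ k x, B.d k (β k x) + β (k + 1) (B.d (k + 1) x) = x - φ (k + 1) (ψ (k + 1) x)

variable (A : TopComplex.{u})

/-- The space of cocycles `Ker d_k`, with the subspace topology. -/
abbrev cocycles (k : ℕ) : Submodule ℝ (A.X k) := LinearMap.ker (A.d k).toLinearMap

/-- The image of `d_{k-1}` in `A^k`; it is zero for `k = 0`. -/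
def boundaries : ∀ k : ℕ, Submodule ℝ (A.X k)
  | 0 => ⊥
  | k + 1 => LinearMap.range (A.d k).toLinearMap

/-- The `k`-th cohomology space `Ker d_k / Im d_{k-1}`, with the quotient topology. -/
abbrev cohomology (k : ℕ) : Type u :=
  A.cocycles k ⧸ (A.boundaries k).comap (A.cocycles k).subtype

/-- The `k`-th reduced cohomology space `Ker d_k / closure (Im d_{k-1})` (the closure is taken in
`A^k`), with the quotient topology. For `k = 0` it is `Ker d_0`, as `A⁰` is Hausdorff. -/
abbrev reducedCohomology (k : ℕ) : Type u :=
  A.cocycles k ⧸ ((A.boundaries k).topologicalClosure).comap (A.cocycles k).subtype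

end TopComplex

/-- The cancellation behind `d ∘ d = 0` for alternating sums of coface maps. -/
theorem alternating_sum_sum_eq_zero {V : Type*} [AddCommGroup V] [Module ℝ V] {k : ℕ}
    (D : Fin (k + 2) → Fin (k + 1) → V)
    (hD : ∀ i j, D i j = D (i.succAbove j) (j.predAbove i)) :
    ∑ i : Fin (k + 2), ∑ j : Fin (k + 1),
      ((-1 : ℝ) ^ (i : ℕ) * (-1 : ℝ) ^ (j : ℕ)) • D i j = 0 := by
  have e := Fintype.sum_prod_type' (f := fun (i : Fin (k + 2)) (j : Fin (k + 1)) =>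
    ((-1 : ℝ) ^ (i : ℕ) * (-1 : ℝ) ^ (j : ℕ)) • D i j)
  rw [← e]
  refine Finset.sum_involution (fun q _ => (q.1.succAbove q.2, q.2.predAbove q.1)) ?_ ?_ ?_ ?_
  · rintro ⟨i, j⟩ -
    have h := Fin.neg_one_pow_succAbove_add_predAbove (R := ℝ) i j
    rw [pow_add, pow_add] at h
    simp only [h, ← hD i j, neg_smul]
    abel
  · rintro ⟨i, j⟩ - - h
    exact Fin.succAbove_ne i j (congrArg Prod.fst h)
  · intros; exact Finset.mem_univ _
  · rintro ⟨i, j⟩ -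
    simp [Fin.succAbove_succAbove_predAbove, Fin.predAbove_predAbove_succAbove]

/-! ### Continuous cohomology -/

section Continuous

variable {G : Type u} [Group G] [TopologicalSpace G] [IsTopologicalGroup G]
  {V : Type u} [AddCommGroup V] [Module ℝ V] [TopologicalSpace V] [IsTopologicalAddGroup V]
  [ContinuousSMul ℝ V]

/-- The map `f ↦ π(g) ∘ f ∘ (left translation by g⁻¹)`, i.e. the action of `g` on
`C^k(G, V) = C(G^{k+1}, V)`: `(g · f)(x₀, …, x_k) = π(g) (f (g⁻¹ x₀, …, g⁻¹ x_k))`. -/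
def cochainAction (π : G →* (V →L[ℝ] V)) (k : ℕ) (g : G) (f : C(Fin (k + 1) → G, V)) :
    C(Fin (k + 1) → G, V) where
  toFun x := π g (f fun i => g⁻¹ * x i)
  continuous_toFun := by fun_prop

/-- The space `C^k(G, V)^G` of `G`-invariant continuous cochains (with the topology induced by
the compact-open topology). -/
def invariantCochains (π : G →* (V →L[ℝ] V)) (k : ℕ) : Submodule ℝ C(Fin (k + 1) → G, V) where
  carrier := {f | ∀ g, cochainAction π k g f = f}
  zero_mem' g := by ext x; simp [cochainAction]
  add_mem' {f₁ f₂} h₁ h₂ g := by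
    ext x
    have e₁ := DFunLike.congr_fun (h₁ g) x
    have e₂ := DFunLike.congr_fun (h₂ g) x
    simp only [cochainAction, ContinuousMap.coe_mk] at e₁ e₂
    simp [cochainAction, e₁, e₂]
  smul_mem' c f h g := by
    ext x
    have e := DFunLike.congr_fun (h g) x
    simp only [cochainAction, ContinuousMap.coe_mk] at e
    simp [cochainAction, e]

/-- The differential of continuous cochains,
`(d f)(x₀, …, x_{k+1}) = ∑ᵢ (-1)ⁱ f(x₀, …, x̂ᵢ, …, x_{k+1})`. -/
def cochainD (G : Type u) [TopologicalSpace G] (V : Type u) [AddCommGroup V] [Module ℝ V]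
    [TopologicalSpace V] [IsTopologicalAddGroup V] [ContinuousSMul ℝ V] (k : ℕ) :
    C(Fin (k + 1) → G, V) →L[ℝ] C(Fin (k + 2) → G, V) where
  toFun f :=
    { toFun := fun x => ∑ i : Fin (k + 2), (-1 : ℝ) ^ (i : ℕ) • f (i.removeNth x)
      continuous_toFun := by unfold Fin.removeNth; fun_prop }
  map_add' f₁ f₂ := by ext x; simp [Finset.sum_add_distrib]
  map_smul' c f := by ext x; simp [Finset.smul_sum, smul_comm c]
  cont := by
    have h : ∀ i : Fin (k + 2), Continuous fun x : Fin (k + 2) → G => i.removeNth x := by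
      intro i; unfold Fin.removeNth; fun_prop
    let c : Fin (k + 2) → C(Fin (k + 2) → G, Fin (k + 1) → G) := fun i => ⟨_, h i⟩
    have : Continuous fun f : C(Fin (k + 1) → G, V) =>
        ∑ i : Fin (k + 2), (-1 : ℝ) ^ (i : ℕ) • f.comp (c i) := by
      refine continuous_finsetSum _ fun i _ => ?_
      have hc : Continuous fun f : C(Fin (k + 1) → G, V) => f.comp (c i) :=
        ContinuousMap.continuous_precomp (c i)
      exact hc.const_smul ((-1 : ℝ) ^ (i : ℕ))
    convert this using 2 with f
    ext x
    simp [c]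

/-- The complex `C^*(G, V)^G`, whose cohomology is the continuous cohomology of `G` with
coefficients in `(π, V)`. -/
def continuousComplex [LocallyConvexSpace ℝ V] [T2Space V] (π : G →* (V →L[ℝ] V)) :
    TopComplex.{u} where
  X k := invariantCochains π k
  d k := ((cochainD G V k).comp (invariantCochains π k).subtypeL).codRestrict
    (invariantCochains π (k + 1)) (by
      rintro ⟨f, hf⟩ g
      ext x
      simp only [cochainAction, cochainD, ContinuousLinearMap.comp_apply,
        Submodule.subtypeL_apply, ContinuousLinearMap.coe_mk', LinearMap.coe_mk, AddHom.coe_mk,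
        ContinuousMap.coe_mk, map_sum, map_smul]
      refine Finset.sum_congr rfl fun i _ => ?_
      congr 1
      exact DFunLike.congr_fun (hf g) (i.removeNth x))
  d_comp_d k := by
    rintro ⟨f, hf⟩
    ext x
    have := alternating_sum_sum_eq_zero
      (fun (i : Fin (k + 3)) (j : Fin (k + 2)) => f (j.removeNth (i.removeNth x)))
      (fun i j => by rw [Fin.removeNth_removeNth_eq_swap])
    simp only [← smul_smul, ← Finset.smul_sum] at this
    exact this

end Continuous

/-! ### The right regular representation on `L^p(G)` -/

section RightRegular

variable {G : Type u} [Group G] [TopologicalSpace G] [IsTopologicalGroup G]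
  [LocallyCompactSpace G] [SecondCountableTopology G] [MeasurableSpace G] [BorelSpace G]
  (μ : Measure G) [μ.IsHaarMeasure] (p : ℝ≥0∞)

theorem map_mul_right_eq (g : G) :
    μ.map (· * g) = (Measure.modularCharacterFun g : ℝ≥0∞) • μ := by
  rw [Measure.modularCharacterFun_eq_haarScalarFactor μ]
  exact Measure.isMulLeftInvariant_eq_smul _ μ

theorem memLp_mul_right (g : G) {u : G → ℝ} (hu : MemLp u p μ) :
    MemLp (fun x => u (x * g)) p μ :=
  (hu.of_measure_le_smul ENNReal.coe_ne_top (map_mul_right_eq μ g).le).comp_of_map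
    (measurable_mul_const g).aemeasurable

theorem quasiMeasurePreserving_mul_right' (g : G) :
    Measure.QuasiMeasurePreserving (· * g) μ μ :=
  ⟨measurable_mul_const g, Measure.absolutelyContinuous_of_le_smul (map_mul_right_eq μ g).le⟩

variable [Fact (1 ≤ p)]

/-- The operator `π(g)` of `L^p(G)`: `(π(g) u)(x) = u(x g)`. -/
noncomputable def rightTranslation (g : G) : Lp ℝ p μ →L[ℝ] Lp ℝ p μ :=
  LinearMap.mkContinuous
    { toFun := fun u => (memLp_mul_right μ p g (Lp.memLp u)).toLp (fun x => u (x * g))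
      map_add' := by
        intro u v
        refine Lp.ext ?_
        have h := (quasiMeasurePreserving_mul_right' μ g).ae (Lp.coeFn_add u v)
        filter_upwards [MemLp.coeFn_toLp (memLp_mul_right μ p g (Lp.memLp (u + v))),
          Lp.coeFn_add ((memLp_mul_right μ p g (Lp.memLp u)).toLp _)
            ((memLp_mul_right μ p g (Lp.memLp v)).toLp _),
          MemLp.coeFn_toLp (memLp_mul_right μ p g (Lp.memLp u)),
          MemLp.coeFn_toLp (memLp_mul_right μ p g (Lp.memLp v)), h] with x h₁ h₂ h₃ h₄ h₅
        rw [h₁, h₂, Pi.add_apply, h₃, h₄, h₅, Pi.add_apply]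
      map_smul' := by
        intro c u
        refine Lp.ext ?_
        have h := (quasiMeasurePreserving_mul_right' μ g).ae (Lp.coeFn_smul c u)
        filter_upwards [MemLp.coeFn_toLp (memLp_mul_right μ p g (Lp.memLp (c • u))),
          Lp.coeFn_smul c ((memLp_mul_right μ p g (Lp.memLp u)).toLp _),
          MemLp.coeFn_toLp (memLp_mul_right μ p g (Lp.memLp u)), h] with x h₁ h₂ h₃ h₄
        rw [h₁, RingHom.id_apply, h₂, Pi.smul_apply, h₃, h₄, Pi.smul_apply] }
    ((Measure.modularCharacterFun g : ℝ≥0∞) ^ (1 / p).toReal).toReal (by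
      intro u
      have hle : eLpNorm (fun x => u (x * g)) p μ ≤
          (Measure.modularCharacterFun g : ℝ≥0∞) ^ (1 / p).toReal * eLpNorm u p μ := by
        have hu : AEStronglyMeasurable u (μ.map (· * g)) :=
          ((Lp.memLp u).of_measure_le_smul ENNReal.coe_ne_top (map_mul_right_eq μ g).le).1
        have h := eLpNorm_map_measure (p := p) hu (measurable_mul_const g).aemeasurable
        have h' := eLpNorm_le_of_measure_le_smul (map_mul_right_eq μ g).le (f := u) (p := p)
        rw [h] at h'
        exact h'
      have hfin : (Measure.modularCharacterFun g : ℝ≥0∞) ^ (1 / p).toReal ≠ ∞ :=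
        ENNReal.rpow_ne_top_of_nonneg ENNReal.toReal_nonneg ENNReal.coe_ne_top
      have hn : ‖(memLp_mul_right μ p g (Lp.memLp u)).toLp (fun x => u (x * g))‖ ≤
          ((Measure.modularCharacterFun g : ℝ≥0∞) ^ (1 / p).toReal).toReal * ‖u‖ := by
        rw [Lp.norm_toLp, Lp.norm_def, ← ENNReal.toReal_mul]
        exact ENNReal.toReal_mono (ENNReal.mul_ne_top hfin (Lp.memLp u).2.ne) hle
      exact hn)

theorem rightTranslation_apply (g : G) (u : Lp ℝ p μ) :
    rightTranslation μ p g u =ᵐ[μ] fun x => u (x * g) :=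
  (memLp_mul_right μ p g (Lp.memLp u)).coeFn_toLp

/-- The right regular representation of `G` on `L^p(G)` (for a left Haar measure `μ`). -/
noncomputable def rightRegular : G →* (Lp ℝ p μ →L[ℝ] Lp ℝ p μ) where
  toFun := rightTranslation μ p
  map_one' := by
    ext1 u
    refine Lp.ext ?_
    filter_upwards [rightTranslation_apply μ p 1 u] with x h
    rw [h, mul_one, one_apply_eq_self]
  map_mul' g h := by
    ext1 u
    refine Lp.ext ?_
    filter_upwards [rightTranslation_apply μ p (g * h) u,
      rightTranslation_apply μ p g (rightTranslation μ p h u),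
      (quasiMeasurePreserving_mul_right' μ g).ae (rightTranslation_apply μ p h u)]
      with x h₁ h₂ h₃
    rw [h₁, mul_apply_eq_comp, h₂, h₃, mul_assoc]

/-- The complex `C^*(G, L^p(G))^G` computing the group `L^p`-cohomology of `G`. -/
noncomputable def groupLpComplex : TopComplex.{u} := continuousComplex (rightRegular μ p)

end RightRegular

/-! ### Asymptotic `L^p`-cohomology of metric measure spaces -/

section Asymptotic

/-- Bounded geometry of a metric measure space: the measure of the balls of radius `r > 0` is
bounded below and above by positive numbers that depend only (and monotonically) on `r`. -/
class BoundedGeometry {X : Type u} [MetricSpace X] [MeasurableSpace X] (μ : Measure X) :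
    Prop where
  exists_bounds : ∃ v V : ℝ → ℝ, MonotoneOn v (Set.Ioi 0) ∧ MonotoneOn V (Set.Ioi 0) ∧
    (∀ r > 0, 0 < v r ∧ 0 < V r) ∧
    ∀ (x : X) (r : ℝ), 0 < r → ENNReal.ofReal (v r) ≤ μ (Metric.ball x r) ∧
      μ (Metric.ball x r) ≤ ENNReal.ofReal (V r)

variable {X : Type u} [MetricSpace X]

/-- `Δ_s^{(k)} = {(x₀, …, x_k) | d(xᵢ, xⱼ) ≤ s for all i, j}`. -/
def diagNhd (X : Type u) [MetricSpace X] (k : ℕ) (s : ℝ) : Set (Fin (k + 1) → X) :=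
  {x | ∀ i j, dist (x i) (x j) ≤ s}

theorem isClosed_diagNhd (k : ℕ) (s : ℝ) : IsClosed (diagNhd X k s) := by
  simp only [diagNhd, Set.ofPred_forall]
  exact isClosed_iInter fun i => isClosed_iInter fun j =>
    isClosed_le (by fun_prop) continuous_const

variable [MeasurableSpace X]

/-- The product measure on `X^{k+1}`. -/
noncomputable abbrev powMeasure (μ : Measure X) (k : ℕ) : Measure (Fin (k + 1) → X) :=
  Measure.pi fun _ => μ

variable (μ : Measure X) (p : ℝ≥0∞)

/-- The space `AS^{k,p}(X)` of classes (modulo almost everywhere equality) of measurable functions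
`u : X^{k+1} → ℝ` whose `p`-norm over `Δ_s^{(k)}` is finite for every `s > 0`. -/
def asSubmodule (k : ℕ) : Submodule ℝ ((Fin (k + 1) → X) →ₘ[powMeasure μ k] ℝ) where
  carrier := {u | ∀ s : ℝ, 0 < s → MemLp u p ((powMeasure μ k).restrict (diagNhd X k s))}
  zero_mem' s _ := by
    refine (memLp_congr_ae ?_).2 MemLp.zero
    exact ae_restrict_of_ae AEEqFun.coeFn_zero
  add_mem' {u v} hu hv s hs :=
    (memLp_congr_ae (ae_restrict_of_ae (AEEqFun.coeFn_add u v))).2 ((hu s hs).add (hv s hs))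
  smul_mem' c u hu s hs :=
    (memLp_congr_ae (ae_restrict_of_ae (AEEqFun.coeFn_smul c u))).2 ((hu s hs).const_smul c)

/-- The type underlying the topological vector space `AS^{k,p}(X)`. -/
abbrev ASpace (k : ℕ) : Type u := asSubmodule μ p k

variable [hp : Fact (1 ≤ p)]

/-- The seminorm `N_s(u) = (∫_{Δ_s} |u|^p)^{1/p}` on `AS^{k,p}(X)`, for `s > 0`. -/
noncomputable def asSeminorm (k : ℕ) (s : {s : ℝ // 0 < s}) : Seminorm ℝ (ASpace μ p k) :=
  Seminorm.of
    (fun u => (eLpNorm u.1 p ((powMeasure μ k).restrict (diagNhd X k s))).toReal)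
    (by
      intro u v
      have hu := u.2 s s.2
      have hv := v.2 s s.2
      rw [← ENNReal.toReal_add hu.2.ne hv.2.ne]
      refine ENNReal.toReal_mono (ENNReal.add_ne_top.2 ⟨hu.2.ne, hv.2.ne⟩) ?_
      exact (eLpNorm_congr_ae (ae_restrict_of_ae (AEEqFun.coeFn_add u.1 v.1))).trans_le
        (eLpNorm_add_le hu.1 hv.1 hp.out))
    (by
      intro c u
      have e := eLpNorm_congr_ae (p := p)
        (ae_restrict_of_ae (s := diagNhd X k s) (AEEqFun.coeFn_smul c u.1))
      rw [eLpNorm_const_smul] at e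
      rw [← toReal_enorm, ← ENNReal.toReal_mul]
      exact congrArg ENNReal.toReal e)

/-- `AS^{k,p}(X)` carries the topology defined by the family of seminorms `N_s`, `s > 0`. -/
noncomputable instance (k : ℕ) : TopologicalSpace (ASpace μ p k) :=
  haveI : Nonempty {s : ℝ // 0 < s} := ⟨⟨1, one_pos⟩⟩
  (SeminormFamily.moduleFilterBasis (asSeminorm μ p k)).topology

theorem asWithSeminorms (k : ℕ) :
    WithSeminorms (E := ASpace μ p k) (asSeminorm μ p k) :=
  ⟨rfl⟩

instance (k : ℕ) : IsTopologicalAddGroup (ASpace μ p k) :=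
  (asWithSeminorms μ p k).topologicalAddGroup

instance (k : ℕ) : ContinuousSMul ℝ (ASpace μ p k) :=
  (asWithSeminorms μ p k).continuousSMul

instance (k : ℕ) : LocallyConvexSpace ℝ (ASpace μ p k) :=
  (asWithSeminorms μ p k).toLocallyConvexSpace

instance [SecondCountableTopology X] [BorelSpace X] (k : ℕ) : T2Space (ASpace μ p k) := by
  have : T1Space (ASpace μ p k) := by
    refine (asWithSeminorms μ p k).T1_of_separating fun u hu => ?_
    by_contra! h
    refine hu (Subtype.ext (AEEqFun.ext ?_))
    have h0 : ∀ n : ℕ, ∀ᵐ x ∂powMeasure μ k, x ∈ diagNhd X k (n + 1 : ℝ) → u.1 x = 0 := by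
      intro n
      have hs : (0 : ℝ) < n + 1 := by positivity
      have hm := u.2 _ hs
      have hz : (eLpNorm u.1 p ((powMeasure μ k).restrict (diagNhd X k (n + 1)))).toReal = 0 :=
        h ⟨_, hs⟩
      have hz' := ((ENNReal.toReal_eq_zero_iff _).1 hz).resolve_right hm.2.ne
      have := (eLpNorm_eq_zero_iff hm.1 (one_pos.trans_le hp.out).ne').1 hz'
      exact (ae_restrict_iff' (isClosed_diagNhd k _).measurableSet).1 this
    refine EventuallyEq.trans ?_ AEEqFun.coeFn_zero.symm
    filter_upwards [ae_all_iff.2 h0] with x hx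
    obtain ⟨n, hn⟩ := exists_nat_ge (∑ i, ∑ j, dist (x i) (x j))
    refine hx n fun i j => ?_
    have h₁ : dist (x i) (x j) ≤ ∑ j, dist (x i) (x j) :=
      Finset.single_le_sum (f := fun j => dist (x i) (x j)) (fun _ _ => dist_nonneg)
        (Finset.mem_univ j)
    have h₂ : ∑ j, dist (x i) (x j) ≤ ∑ i, ∑ j, dist (x i) (x j) :=
      Finset.single_le_sum (f := fun i => ∑ j, dist (x i) (x j))
        (fun _ _ => Finset.sum_nonneg fun _ _ => dist_nonneg) (Finset.mem_univ i)
    linarith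
  infer_instance

variable [SecondCountableTopology X] [BorelSpace X] [SigmaFinite μ]

theorem quasiMeasurePreserving_removeNth (k : ℕ) (i : Fin (k + 2)) :
    Measure.QuasiMeasurePreserving (fun x : Fin (k + 2) → X => i.removeNth x)
      (powMeasure μ (k + 1)) (powMeasure μ k) := by
  have h := measurePreserving_piFinSuccAbove (fun _ : Fin (k + 2) => μ) i
  exact Measure.quasiMeasurePreserving_snd.comp h.quasiMeasurePreserving

/-- The pullback of a class `u` along the `i`-th face map: `(x₀, …, x_{k+1}) ↦ u(…, x̂ᵢ, …)`. -/
noncomputable def aeFace (k : ℕ) (i : Fin (k + 2)) :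
    ((Fin (k + 1) → X) →ₘ[powMeasure μ k] ℝ) →ₗ[ℝ]
      ((Fin (k + 2) → X) →ₘ[powMeasure μ (k + 1)] ℝ) where
  toFun u := u.compQuasiMeasurePreserving (fun x => i.removeNth x)
      (quasiMeasurePreserving_removeNth μ k i)
  map_add' u v := by
    induction u using AEEqFun.induction_on
    induction v using AEEqFun.induction_on
    rfl
  map_smul' c u := by
    induction u using AEEqFun.induction_on
    rfl

theorem coeFn_aeFace (k : ℕ) (i : Fin (k + 2)) (u : (Fin (k + 1) → X) →ₘ[powMeasure μ k] ℝ) :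
    aeFace μ k i u =ᵐ[powMeasure μ (k + 1)] fun x => u (i.removeNth x) :=
  u.coeFn_compQuasiMeasurePreserving (quasiMeasurePreserving_removeNth μ k i)

theorem aeFace_aeFace (k : ℕ) (i : Fin (k + 3)) (j : Fin (k + 2))
    (u : (Fin (k + 1) → X) →ₘ[powMeasure μ k] ℝ) :
    aeFace μ (k + 1) i (aeFace μ k j u) =
      aeFace μ (k + 1) (i.succAbove j) (aeFace μ k (j.predAbove i) u) := by
  induction u using AEEqFun.induction_on with
  | _ f hf =>
    refine AEEqFun.mk_eq_mk.2 (Eventually.of_forall fun x => ?_)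
    exact congrArg f (Fin.removeNth_removeNth_eq_swap x j i)

variable [BoundedGeometry μ]

/-- In bounded geometry, forgetting one coordinate distorts the measure of `Δ_s` by a bounded
factor. -/
theorem exists_map_removeNth_le (k : ℕ) (i : Fin (k + 2)) (s : ℝ) (hs : 0 < s) :
    ∃ C : ℝ≥0, ((powMeasure μ (k + 1)).restrict (diagNhd X (k + 1) s)).map
      (fun x => i.removeNth x) ≤
        (C : ℝ≥0∞) • (powMeasure μ k).restrict (diagNhd X k s) := by
  obtain ⟨v, V, -, -, -, hV⟩ := BoundedGeometry.exists_bounds (μ := μ)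
  have hm := (quasiMeasurePreserving_removeNth μ k i).measurable
  refine ⟨(V (s + 1)).toNNReal, Measure.le_iff.2 fun A hA => ?_⟩
  have hΔ := (isClosed_diagNhd (X := X) (k + 1) s).measurableSet
  have hΔ' := (isClosed_diagNhd (X := X) k s).measurableSet
  have e := measurePreserving_piFinSuccAbove (fun _ : Fin (k + 2) => μ) i
  set S : Set (X × (Fin (k + 1) → X)) :=
    {q | q.2 ∈ A ∩ diagNhd X k s ∧ dist q.1 (q.2 0) ≤ s} with hS
  have hSm : MeasurableSet S := by
    refine (measurable_snd (hA.inter hΔ')).inter ?_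
    exact (isClosed_le (by fun_prop) continuous_const :
      IsClosed {q : X × (Fin (k + 1) → X) | dist q.1 (q.2 0) ≤ s}).measurableSet
  rw [Measure.map_apply hm hA, Measure.restrict_apply (hm hA), Measure.smul_apply,
    Measure.restrict_apply hA, smul_eq_mul]
  calc powMeasure μ (k + 1) ((fun x => i.removeNth x) ⁻¹' A ∩ diagNhd X (k + 1) s)
      ≤ powMeasure μ (k + 1) (MeasurableEquiv.piFinSuccAbove (fun _ => X) i ⁻¹' S) := by
        refine measure_mono ?_
        rintro x ⟨hxA, hx⟩
        exact ⟨⟨hxA, fun a b => hx _ _⟩, hx _ _⟩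
    _ = (μ.prod (powMeasure μ k)) S := e.measure_preimage hSm.nullMeasurableSet
    _ = ∫⁻ y, μ ((fun a => (a, y)) ⁻¹' S) ∂(powMeasure μ k) := Measure.prod_apply_symm hSm
    _ ≤ ∫⁻ y, (A ∩ diagNhd X k s).indicator (fun _ => ENNReal.ofReal (V (s + 1))) y
          ∂(powMeasure μ k) := by
        refine lintegral_mono fun y => ?_
        by_cases hy : y ∈ A ∩ diagNhd X k s
        · rw [Set.indicator_of_mem hy]
          refine (measure_mono ?_).trans (hV (y 0) (s + 1) (by linarith)).2
          intro a ha
          exact Metric.mem_ball.2 (lt_of_le_of_lt ha.2 (by linarith))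
        · rw [Set.indicator_of_notMem hy]
          have : (fun a => (a, y)) ⁻¹' S = ∅ := by
            ext a
            simp only [Set.mem_preimage, Set.mem_empty_iff_false, iff_false]
            exact fun ha => hy ha.1
          simp [this]
    _ = ((V (s + 1)).toNNReal : ℝ≥0∞) * powMeasure μ k (A ∩ diagNhd X k s) := by
        rw [lintegral_indicator_const (hA.inter hΔ')]
        rfl

theorem exists_eLpNorm_aeFace_le (k : ℕ) (i : Fin (k + 2)) (s : ℝ) (hs : 0 < s) :
    ∃ C : ℝ≥0, ∀ u ∈ asSubmodule μ p k,
      MemLp (aeFace μ k i u) p ((powMeasure μ (k + 1)).restrict (diagNhd X (k + 1) s)) ∧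
      eLpNorm (aeFace μ k i u) p ((powMeasure μ (k + 1)).restrict (diagNhd X (k + 1) s)) ≤
        C * eLpNorm u p ((powMeasure μ k).restrict (diagNhd X k s)) := by
  obtain ⟨C, hC⟩ := exists_map_removeNth_le μ k i s hs
  have hm := (quasiMeasurePreserving_removeNth μ k i).measurable
  refine ⟨C ^ (1 / p).toReal, fun u hu => ?_⟩
  have hu' := (hu s hs).of_measure_le_smul ENNReal.coe_ne_top hC
  have hae := ae_restrict_of_ae (s := diagNhd X (k + 1) s) (coeFn_aeFace μ k i u)
  refine ⟨(memLp_congr_ae hae).2 (hu'.comp_of_map hm.aemeasurable), ?_⟩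
  rw [eLpNorm_congr_ae hae]
  have h := eLpNorm_map_measure (p := p) hu'.1 hm.aemeasurable
  have h' := eLpNorm_le_of_measure_le_smul hC (f := u) (p := p)
  rw [h] at h'
  rw [ENNReal.coe_rpow_of_nonneg _ ENNReal.toReal_nonneg]
  exact h'

/-- The pullback along a face map as a continuous linear map `AS^{k,p}(X) → AS^{k+1,p}(X)`. -/
noncomputable def asFace (k : ℕ) (i : Fin (k + 2)) : ASpace μ p k →L[ℝ] ASpace μ p (k + 1) where
  toLinearMap := (aeFace μ k i).restrict (p := asSubmodule μ p k) (q := asSubmodule μ p (k + 1))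
    fun u hu s hs => by
      obtain ⟨C, hC⟩ := exists_eLpNorm_aeFace_le μ p k i s hs
      exact (hC u hu).1
  cont := by
    refine WithSeminorms.continuous_of_isBounded (asWithSeminorms μ p k)
      (asWithSeminorms μ p (k + 1)) _ fun s => ?_
    obtain ⟨C, hC⟩ := exists_eLpNorm_aeFace_le μ p k i s.1 s.2
    refine ⟨{s}, C, fun u => ?_⟩
    have h := ENNReal.toReal_mono (ENNReal.mul_ne_top ENNReal.coe_ne_top (u.2 s.1 s.2).2.ne)
      (hC u.1 u.2).2
    rw [ENNReal.toReal_mul] at h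
    rw [Finset.sup_singleton]
    exact h

/-- The differential of `AS^{*,p}(X)`,
`(d u)(x₀, …, x_{k+1}) = ∑ᵢ (-1)ⁱ u(x₀, …, x̂ᵢ, …, x_{k+1})`. -/
noncomputable def asD (k : ℕ) : ASpace μ p k →L[ℝ] ASpace μ p (k + 1) :=
  ∑ i : Fin (k + 2), (-1 : ℝ) ^ (i : ℕ) • asFace μ p k i

theorem asD_apply (k : ℕ) (u : ASpace μ p k) :
    asD μ p k u = ∑ i : Fin (k + 2), (-1 : ℝ) ^ (i : ℕ) • asFace μ p k i u := by
  simp [asD]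

/-- The complex `AS^{*,p}(X)`, whose cohomology is the asymptotic `L^p`-cohomology of `X`. -/
noncomputable def asymptoticComplex : TopComplex.{u} where
  X k := ASpace μ p k
  d k := asD μ p k
  d_comp_d k u := by
    have := alternating_sum_sum_eq_zero
      (fun (i : Fin (k + 3)) (j : Fin (k + 2)) => asFace μ p (k + 1) i (asFace μ p k j u))
      (fun i j => Subtype.ext (aeFace_aeFace μ k i j u.1))
    simp only [← smul_smul, ← Finset.smul_sum] at this
    rw [asD_apply, asD_apply]
    simpa only [map_sum, map_smul] using this

end Asymptotic

/-- A left Haar measure on a group with a left-invariant proper metric has bounded geometry. -/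
instance {G : Type u} [Group G] [MetricSpace G] [IsTopologicalGroup G] [ProperSpace G]
    [IsIsometricSMul G G] [MeasurableSpace G] [BorelSpace G] (μ : Measure G)
    [μ.IsHaarMeasure] : BoundedGeometry μ where
  exists_bounds := by
    have hpos : ∀ r : ℝ, 0 < r → 0 < (μ (Metric.ball (1 : G) r)).toReal := fun r hr =>
      ENNReal.toReal_pos (Metric.measure_ball_pos μ 1 hr).ne' measure_ball_lt_top.ne
    have hmono : MonotoneOn (fun r => (μ (Metric.ball (1 : G) r)).toReal) (Set.Ioi 0) :=
      fun r _ t _ h =>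
        ENNReal.toReal_mono measure_ball_lt_top.ne (measure_mono (Metric.ball_subset_ball h))
    refine ⟨_, _, hmono, hmono, fun r hr => ⟨hpos r hr, hpos r hr⟩, fun x r hr => ?_⟩
    have h : μ (Metric.ball x r) = μ (Metric.ball 1 r) := by
      rw [← measure_preimage_mul μ x (Metric.ball x r)]
      congr 1
      ext y
      simp [Metric.mem_ball]
    rw [ENNReal.ofReal_toReal measure_ball_lt_top.ne, h]
    exact ⟨le_rfl, le_rfl⟩

end LpCoh

/-!
The two complexes are compared by viewing an invariant `L^p(G)`-valued cochain as a scalar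
function. If `f : G^{k+1} → L^p(G)` is invariant for the right regular representation, then
formally `f(x)(y) = f(y x)(1)`, so that `f` is determined by the function `u(z) = f(z)(1)` on
`G^{k+1}`. For a continuous `f` this makes sense almost everywhere (`exists_represents`): if
`F(x, y)` is a jointly measurable version of `f(x)(y)`, then `u(z) = F(c⁻¹ z, c)` for a generic
`c`. As Haar measure and the metric are left-invariant, integrating `|f(x)(y)|^p = |u(y x)|^p` over
`y ∈ G` and over `x` in a ball is comparable to integrating `|u|^p` over `Δ_s`. Hence `f ↦ u` is a
continuous cochain map `φ` (`represent`), and it is injective since `f` is continuous.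

In the opposite direction a class `u` need not come from a continuous cochain, and it is
regularized: with `χ` a continuous probability density supported in the unit ball (`bump`),
`(ψ u)(x)(y) = ∫ u(y x₀ t₀, …, y x_k t_k) χ(t₀) ⋯ χ(t_k) dt` (`regularize`). After the substitution
`w = x t` the point `x` occurs only in the continuous kernel `∏ χ(xᵢ⁻¹ wᵢ)`, and this gives the
continuity in `x`. The composite `φ ψ` is the operator `R u(z) = ∫ u(z t) χ(t) dt` (`asReg`), which
is homotopic to the identity by the prism operator
`(β u)(z) = -∑ᵢ (-1)ⁱ ∫ u(z₀, …, zᵢ, zᵢ tᵢ, …, z_k t_k) χ(t) dt` (`asHtpy`). The identity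
`d β + β d = id - R` is the integral over `t` of the pointwise prism identity
`prismSum_removeNth_add_prismSum_altSum`; the boundedness of these operators on `AS^{*,p}(G)` comes
from Jensen's inequality and from the bounds `exists_lintegral_mul_le` and
`exists_lintegral_prism_le` for the images of the measures.

On continuous cochains, `α` is given by the same formula as `β` with Bochner integrals in `L^p(G)`
(`cochainHtpy`), and `φ α = β φ`. Since `φ` is injective, all the identities to be proved for the
continuous complex follow from the identities for the asymptotic complex. A homotopy equivalence
with continuous maps induces isomorphisms of topological vector spaces in cohomology and in reduced
cohomology (`TopComplex.HtpyEquiv.cohomologyEquiv`, `TopComplex.HtpyEquiv.reducedCohomologyEquiv`).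
-/

namespace LpCoh

universe u v

/-! ### Homotopy equivalences induce isomorphisms in cohomology -/

namespace TopComplex

/-- A continuous linear map `f` induces a continuous linear map between subquotients: from
`Z / (B ∩ Z)` to `Z' / (B' ∩ Z')` when `f` maps `Z` to `Z'` and `B` to `B'`. -/
def subquotientMap {E : Type u} {F : Type v} [AddCommGroup E] [Module ℝ E] [TopologicalSpace E]
    [AddCommGroup F] [Module ℝ F] [TopologicalSpace F] (f : E →L[ℝ] F)
    {Z B : Submodule ℝ E} {Z' B' : Submodule ℝ F} (hZ : ∀ x ∈ Z, f x ∈ Z')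
    (hB : ∀ x ∈ B, f x ∈ B') :
    (Z ⧸ B.comap Z.subtype) →L[ℝ] (Z' ⧸ B'.comap Z'.subtype) :=
  (B.comap Z.subtype).liftQL
    ((B'.comap Z'.subtype).mkQL.comp
      ((f.comp Z.subtypeL).codRestrict Z' fun x => hZ x x.2)) (by
    intro x hx
    exact (Submodule.Quotient.mk_eq_zero _).2 (hB _ hx))

theorem subquotientMap_subquotientMap {E : Type u} {F : Type v} [AddCommGroup E] [Module ℝ E]
    [TopologicalSpace E] [AddCommGroup F] [Module ℝ F] [TopologicalSpace F] (f : E →L[ℝ] F)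
    (g : F →L[ℝ] E) {Z B : Submodule ℝ E} {Z' B' : Submodule ℝ F} (hZ : ∀ x ∈ Z, f x ∈ Z')
    (hB : ∀ x ∈ B, f x ∈ B') (hZ' : ∀ x ∈ Z', g x ∈ Z) (hB' : ∀ x ∈ B', g x ∈ B)
    (h : ∀ x ∈ Z, x - g (f x) ∈ B) (x : Z ⧸ B.comap Z.subtype) :
    subquotientMap g hZ' hB' (subquotientMap f hZ hB x) = x := by
  induction x using Submodule.Quotient.induction_on with
  | _ x =>
    refine ((Submodule.Quotient.eq _).2 ?_).symm
    exact h x x.2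

/-- Two continuous linear maps that are mutually inverse up to `B` and `B'` induce an isomorphism
of topological vector spaces between the subquotients. -/
def subquotientEquiv {E : Type u} {F : Type v} [AddCommGroup E] [Module ℝ E]
    [TopologicalSpace E] [AddCommGroup F] [Module ℝ F] [TopologicalSpace F] (f : E →L[ℝ] F)
    (g : F →L[ℝ] E) {Z B : Submodule ℝ E} {Z' B' : Submodule ℝ F} (hZ : ∀ x ∈ Z, f x ∈ Z')
    (hB : ∀ x ∈ B, f x ∈ B') (hZ' : ∀ x ∈ Z', g x ∈ Z) (hB' : ∀ x ∈ B', g x ∈ B)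
    (h : ∀ x ∈ Z, x - g (f x) ∈ B) (h' : ∀ x ∈ Z', x - f (g x) ∈ B') :
    (Z ⧸ B.comap Z.subtype) ≃L[ℝ] (Z' ⧸ B'.comap Z'.subtype) :=
  ContinuousLinearEquiv.equivOfInverse (subquotientMap f hZ hB) (subquotientMap g hZ' hB')
    (subquotientMap_subquotientMap f g hZ hB hZ' hB' h)
    (subquotientMap_subquotientMap g f hZ' hB' hZ hB h')

variable {A : TopComplex.{u}} {B : TopComplex.{v}}

theorem map_mem_cocycles (φ : ∀ k, A.X k →L[ℝ] B.X k)
    (hφ : ∀ k x, φ (k + 1) (A.d k x) = B.d k (φ k x)) (k : ℕ) :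
    ∀ x ∈ A.cocycles k, φ k x ∈ B.cocycles k := by
  intro x hx
  have hx' : A.d k x = 0 := hx
  change B.d k (φ k x) = 0
  rw [← hφ, hx', map_zero]

theorem map_mem_boundaries (φ : ∀ k, A.X k →L[ℝ] B.X k)
    (hφ : ∀ k x, φ (k + 1) (A.d k x) = B.d k (φ k x)) (k : ℕ) :
    ∀ x ∈ A.boundaries k, φ k x ∈ B.boundaries k := by
  intro x hx
  cases k with
  | zero =>
    have hx' : x = 0 := (Submodule.mem_bot ℝ).1 hx
    rw [hx', map_zero]
    exact zero_mem _
  | succ k =>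
    obtain ⟨y, hy⟩ := hx
    refine ⟨φ k y, ?_⟩
    have hy' : A.d k y = x := hy
    change B.d k (φ k y) = _
    rw [← hy', hφ]

theorem map_mem_closure_boundaries (φ : ∀ k, A.X k →L[ℝ] B.X k)
    (hφ : ∀ k x, φ (k + 1) (A.d k x) = B.d k (φ k x)) (k : ℕ) :
    ∀ x ∈ (A.boundaries k).topologicalClosure, φ k x ∈ (B.boundaries k).topologicalClosure :=
  fun _ hx => map_mem_closure (φ k).continuous hx (map_mem_boundaries φ hφ k)

/-- A map homotopic to the identity differs from the identity by boundaries on cocycles. -/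
theorem sub_mem_boundaries (r : ∀ k, A.X k → A.X k) (α : ∀ k, A.X (k + 1) →L[ℝ] A.X k)
    (h₀ : ∀ x, α 0 (A.d 0 x) = x - r 0 x)
    (h : ∀ k x, A.d k (α k x) + α (k + 1) (A.d (k + 1) x) = x - r (k + 1) x) (k : ℕ) :
    ∀ x ∈ A.cocycles k, x - r k x ∈ A.boundaries k := by
  intro x hx
  have hx' : A.d k x = 0 := hx
  cases k with
  | zero =>
    rw [← h₀, hx', map_zero]
    exact zero_mem _
  | succ k =>
    rw [← h, hx', map_zero, add_zero]
    exact ⟨α k x, rfl⟩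

/-- The isomorphism of cohomology spaces induced by a homotopy equivalence. -/
def HtpyEquiv.cohomologyEquiv (e : HtpyEquiv A B) (k : ℕ) :
    A.cohomology k ≃L[ℝ] B.cohomology k :=
  subquotientEquiv (e.φ k) (e.ψ k) (map_mem_cocycles e.φ e.φ_d k)
    (map_mem_boundaries e.φ e.φ_d k) (map_mem_cocycles e.ψ e.ψ_d k)
    (map_mem_boundaries e.ψ e.ψ_d k)
    (sub_mem_boundaries (fun k x => e.ψ k (e.φ k x)) e.α e.α_zero e.α_succ k)
    (sub_mem_boundaries (fun k x => e.φ k (e.ψ k x)) e.β e.β_zero e.β_succ k)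

/-- The isomorphism of reduced cohomology spaces induced by a homotopy equivalence. -/
def HtpyEquiv.reducedCohomologyEquiv (e : HtpyEquiv A B) (k : ℕ) :
    A.reducedCohomology k ≃L[ℝ] B.reducedCohomology k :=
  subquotientEquiv (e.φ k) (e.ψ k) (map_mem_cocycles e.φ e.φ_d k)
    (map_mem_closure_boundaries e.φ e.φ_d k) (map_mem_cocycles e.ψ e.ψ_d k)
    (map_mem_closure_boundaries e.ψ e.ψ_d k)
    (fun x hx => (A.boundaries k).le_topologicalClosure
      (sub_mem_boundaries (fun k x => e.ψ k (e.φ k x)) e.α e.α_zero e.α_succ k x hx))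
    (fun x hx => (B.boundaries k).le_topologicalClosure
      (sub_mem_boundaries (fun k x => e.φ k (e.ψ k x)) e.β e.β_zero e.β_succ k x hx))

end TopComplex

/-! ### The prism identity -/

section Prism

/-- The `i`-th prism `(z₀, …, zᵢ, z'ᵢ, …, z'_{n-1})` over two `n`-tuples `z` and `z'`. -/
def prism {X : Type*} {n : ℕ} (i : Fin n) (z z' : Fin n → X) : Fin (n + 1) → X :=
  fun j => if j ≤ i.castSucc then z (i.predAbove j) else z' (i.predAbove j)

variable {X : Type*}

theorem prism_zero {n : ℕ} (z z' : Fin (n + 1) → X) :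
    prism 0 z z' = Fin.cons (z 0) z' := by
  ext j
  refine Fin.cases ?_ (fun j => ?_) j
  · simp [prism]
  · simp [prism]

theorem prism_succ {n : ℕ} (i : Fin n) (z z' : Fin (n + 1) → X) :
    prism i.succ z z' = Fin.cons (z 0) (prism i (Fin.tail z) (Fin.tail z')) := by
  ext j
  refine Fin.cases ?_ (fun j => ?_) j
  · simp [prism]
  · simp only [prism, Fin.cons_succ, Fin.tail, Fin.succ_predAbove_succ, Fin.castSucc_succ,
      Fin.succ_le_succ_iff]

variable {V : Type*} [AddCommGroup V] [Module ℝ V]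

/-- The alternating sum `∑ⱼ (-1)ʲ u(x₀, …, x̂ⱼ, …, x_n)` for a function `u` of `n` variables. -/
def altSum {n : ℕ} (u : (Fin n → X) → V) (x : Fin (n + 1) → X) : V :=
  ∑ j : Fin (n + 1), (-1 : ℝ) ^ (j : ℕ) • u (j.removeNth x)

/-- The alternating sum `∑ᵢ (-1)ⁱ u(z₀, …, zᵢ, z'ᵢ, …, z'_{n-1})` of a function over the prisms
on two tuples. -/
def prismSum {n : ℕ} (u : (Fin (n + 1) → X) → V) (z z' : Fin n → X) : V :=
  ∑ i : Fin n, (-1 : ℝ) ^ (i : ℕ) • u (prism i z z')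

theorem removeNth_succ_cons {n : ℕ} (j : Fin (n + 1)) (a : X) (x : Fin (n + 1) → X) :
    j.succ.removeNth (Fin.cons a x : Fin (n + 2) → X) = Fin.cons a (j.removeNth x) := by
  ext l
  refine Fin.cases ?_ (fun l => ?_) l <;> simp [Fin.removeNth]

theorem removeNth_zero_cons {n : ℕ} (a : X) (x : Fin n → X) :
    (0 : Fin (n + 1)).removeNth (Fin.cons a x : Fin (n + 1) → X) = x := by
  ext l
  simp [Fin.removeNth]

theorem altSum_cons {n : ℕ} (u : (Fin (n + 1) → X) → V) (a : X) (x : Fin (n + 1) → X) :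
    altSum u (Fin.cons a x) = u x - altSum (fun y => u (Fin.cons a y)) x := by
  simp only [altSum, Fin.sum_univ_succ (n := n + 1), removeNth_zero_cons, removeNth_succ_cons,
    Fin.val_zero, pow_zero, one_smul, Fin.val_succ, pow_succ, mul_neg, mul_one, neg_smul,
    Finset.sum_neg_distrib, sub_eq_add_neg]

theorem prismSum_cons {n : ℕ} (u : (Fin (n + 2) → X) → V) (a b : X) (z z' : Fin n → X) :
    prismSum u (Fin.cons a z : Fin (n + 1) → X) (Fin.cons b z') =
      u (Fin.cons a (Fin.cons b z')) - prismSum (fun y => u (Fin.cons a y)) z z' := by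
  simp only [prismSum, Fin.sum_univ_succ, prism_zero, prism_succ, Fin.cons_zero, Fin.tail_cons,
    Fin.val_zero, pow_zero, one_smul, Fin.val_succ, pow_succ, mul_neg, mul_one, neg_smul,
    Finset.sum_neg_distrib, sub_eq_add_neg]

theorem prismSum_sub {n : ℕ} (u v : (Fin (n + 1) → X) → V) (z z' : Fin n → X) :
    prismSum (fun y => u y - v y) z z' = prismSum u z z' - prismSum v z z' := by
  simp [prismSum, smul_sub]

/-- The prism identity: the alternating sum over prisms is a homotopy between the evaluations at
`z` and at `z'`. By induction on the number of variables, fixing the first one. -/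
theorem prismSum_removeNth_add_prismSum_altSum {n : ℕ} (u : (Fin (n + 1) → X) → V)
    (z z' : Fin (n + 1) → X) :
    ∑ j : Fin (n + 1), (-1 : ℝ) ^ (j : ℕ) • prismSum u (j.removeNth z) (j.removeNth z') +
      prismSum (altSum u) z z' = u z' - u z := by
  induction n with
  | zero =>
    have e : ∀ x : Fin 1 → X, x = Fin.cons (x 0) Fin.elim0 := fun x => by
      ext j; rw [Subsingleton.elim j 0]; rfl
    rw [e z, e z', prismSum_cons, altSum_cons]
    simp [prismSum, altSum]
  | succ n ih =>
    induction z using Fin.consCases with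
    | _ a y =>
    induction z' using Fin.consCases with
    | _ b y' =>
    have ih' := ih (fun x => u (Fin.cons a x)) y y'
    rw [Fin.sum_univ_succ, prismSum_cons, altSum_cons, altSum_cons]
    simp only [removeNth_zero_cons, removeNth_succ_cons, prismSum_cons, altSum_cons, prismSum_sub,
      Fin.val_zero, pow_zero, one_smul, Fin.val_succ, pow_succ, mul_neg, mul_one, neg_smul,
      Finset.sum_neg_distrib, smul_sub, Finset.sum_sub_distrib]
    rw [← eq_sub_iff_add_eq'] at ih'
    rw [ih']
    simp only [altSum]
    abel

end Prism

/-! ### Averages of `L^p` functions -/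

section Averages

variable {S T : Type*} [MeasurableSpace S] [MeasurableSpace T] {l : Measure S} [SFinite l]
  {ν : Measure T} [IsFiniteMeasure ν] {p : ℝ≥0∞}

theorem _root_.MeasureTheory.MemLp.ae_memLp_prodMk (hp : 1 ≤ p) (hp' : p ≠ ∞) {h : S × T → ℝ}
    (hh : MemLp h p (l.prod ν)) : ∀ᵐ x ∂l, MemLp (fun t => h (x, t)) p ν := by
  have hp0 : p ≠ 0 := (one_pos.trans_le hp).ne'
  have h1 := (integrable_norm_rpow_iff hh.1 hp0 hp').2 hh
  filter_upwards [h1.prod_right_ae, hh.1.prodMk_left] with x hx hx'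
  exact (integrable_norm_rpow_iff hx' hp0 hp').1 hx

/-- Jensen's (or Minkowski's) inequality for the average of a function `h` of two variables
against a bounded weight in the second variable. -/
theorem eLpNorm_integral_mul_le (hp : 1 ≤ p) (hp' : p ≠ ∞) {h : S × T → ℝ}
    (hh : AEStronglyMeasurable h (l.prod ν)) {a : T → ℝ} {M : ℝ≥0} (ha : ∀ t, ‖a t‖ₑ ≤ M) :
    eLpNorm (fun x => ∫ t, a t * h (x, t) ∂ν) p l ≤
      (M * ν Set.univ ^ (1 - 1 / p.toReal)) * eLpNorm h p (l.prod ν) := by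
  have hp0 : p ≠ 0 := (one_pos.trans_le hp).ne'
  have hpr : 0 < p.toReal := ENNReal.toReal_pos hp0 hp'
  have hpr1 : 1 ≤ p.toReal := by
    rw [← ENNReal.toReal_one]; exact ENNReal.toReal_mono hp' hp
  set K : ℝ≥0∞ := M * ν Set.univ ^ (1 - 1 / p.toReal) with hK
  have hKtop : K ≠ ∞ := by
    refine ENNReal.mul_ne_top ENNReal.coe_ne_top
      (ENNReal.rpow_ne_top_of_nonneg ?_ (measure_ne_top _ _))
    rw [sub_nonneg, div_le_one hpr]
    exact hpr1
  have key : ∀ᵐ x ∂l, ‖∫ t, a t * h (x, t) ∂ν‖ₑ ≤ K * eLpNorm (fun t => h (x, t)) p ν := by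
    filter_upwards [hh.prodMk_left] with x hx
    calc ‖∫ t, a t * h (x, t) ∂ν‖ₑ ≤ ∫⁻ t, ‖a t * h (x, t)‖ₑ ∂ν :=
          enorm_integral_le_lintegral_enorm _
      _ ≤ ∫⁻ t, M * ‖h (x, t)‖ₑ ∂ν := by
          refine lintegral_mono fun t => ?_
          rw [enorm_mul]
          exact mul_le_mul_left (ha t) _
      _ = M * eLpNorm (fun t => h (x, t)) 1 ν := by
          rw [lintegral_const_mul' _ _ ENNReal.coe_ne_top, eLpNorm_one_eq_lintegral_enorm]
      _ ≤ M * (eLpNorm (fun t => h (x, t)) p ν *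
            ν Set.univ ^ (1 / (1 : ℝ≥0∞).toReal - 1 / p.toReal)) :=
          mul_le_mul_right (eLpNorm_le_eLpNorm_mul_rpow_measure_univ hp hx) _
      _ = K * eLpNorm (fun t => h (x, t)) p ν := by
          rw [hK, ENNReal.toReal_one, div_one]; ring
  rw [eLpNorm_eq_lintegral_rpow_enorm_toReal hp0 hp',
    eLpNorm_eq_lintegral_rpow_enorm_toReal hp0 hp']
  have hpow : AEMeasurable (fun q => ‖h q‖ₑ ^ p.toReal) (l.prod ν) := hh.enorm.pow_const _
  calc (∫⁻ x, ‖∫ t, a t * h (x, t) ∂ν‖ₑ ^ p.toReal ∂l) ^ (1 / p.toReal)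
      ≤ (∫⁻ x, K ^ p.toReal * ∫⁻ t, ‖h (x, t)‖ₑ ^ p.toReal ∂ν ∂l) ^ (1 / p.toReal) := by
        refine ENNReal.rpow_le_rpow (lintegral_mono_ae ?_) (by positivity)
        filter_upwards [key] with x hx
        refine (ENNReal.rpow_le_rpow hx hpr.le).trans_eq ?_
        rw [ENNReal.mul_rpow_of_nonneg _ _ hpr.le,
          eLpNorm_eq_lintegral_rpow_enorm_toReal hp0 hp', ← ENNReal.rpow_mul,
          one_div_mul_cancel hpr.ne', ENNReal.rpow_one]
    _ = K * (∫⁻ q, ‖h q‖ₑ ^ p.toReal ∂(l.prod ν)) ^ (1 / p.toReal) := by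
        rw [lintegral_const_mul' _ _ (ENNReal.rpow_ne_top_of_nonneg hpr.le hKtop),
          ← lintegral_prod _ hpow, ENNReal.mul_rpow_of_nonneg _ _ (by positivity),
          ← ENNReal.rpow_mul, mul_one_div_cancel hpr.ne', ENNReal.rpow_one]

variable {Y : Type*} [MeasurableSpace Y] {ρ : Measure Y} {m : S × T → Y} {C : ℝ≥0}

theorem memLp_comp_of_map_le (hm : Measurable m)
    (hC : (l.prod ν).map m ≤ (C : ℝ≥0∞) • ρ) {u : Y → ℝ} (hu : MemLp u p ρ) :
    MemLp (fun q => u (m q)) p (l.prod ν) :=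
  (hu.of_measure_le_smul ENNReal.coe_ne_top hC).comp_of_map hm.aemeasurable

theorem eLpNorm_comp_le_of_map_le (hm : Measurable m)
    (hC : (l.prod ν).map m ≤ (C : ℝ≥0∞) • ρ) {u : Y → ℝ} (hu : MemLp u p ρ) :
    eLpNorm (fun q => u (m q)) p (l.prod ν) ≤
      (C : ℝ≥0∞) ^ (1 / p).toReal * eLpNorm u p ρ := by
  have h := eLpNorm_map_measure (p := p) (hu.of_measure_le_smul ENNReal.coe_ne_top hC).1
    hm.aemeasurable
  have h' := eLpNorm_le_of_measure_le_smul hC (f := u) (p := p)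
  rw [h] at h'
  exact h'

/-- If `(x, t) ↦ m (x, t)` pushes `l × ν` to a measure at most `C • ρ`, the weighted averages
`x ↦ ∫ a(t) u(m(x, t)) dν(t)` are controlled in `L^p(l)` by `u` in `L^p(ρ)`. -/
theorem eLpNorm_integral_comp_le (hp : 1 ≤ p) (hp' : p ≠ ∞) (hm : Measurable m)
    (hC : (l.prod ν).map m ≤ (C : ℝ≥0∞) • ρ) {a : T → ℝ} {M : ℝ≥0} (ha : ∀ t, ‖a t‖ₑ ≤ M)
    {u : Y → ℝ} (hu : MemLp u p ρ) :
    eLpNorm (fun x => ∫ t, a t * u (m (x, t)) ∂ν) p l ≤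
      M * (ν Set.univ ^ (1 - 1 / p.toReal) * (C : ℝ≥0∞) ^ (1 / p).toReal) * eLpNorm u p ρ := by
  refine (eLpNorm_integral_mul_le hp hp' (memLp_comp_of_map_le hm hC hu).1 ha).trans ?_
  refine (mul_le_mul_right (eLpNorm_comp_le_of_map_le hm hC hu) _).trans_eq ?_
  ring

theorem ae_integrable_comp_of_map_le (hp : 1 ≤ p) (hp' : p ≠ ∞) (hm : Measurable m)
    (hC : (l.prod ν).map m ≤ (C : ℝ≥0∞) • ρ) {u : Y → ℝ} (hu : MemLp u p ρ) :
    ∀ᵐ x ∂l, Integrable (fun t => u (m (x, t))) ν := by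
  filter_upwards [(memLp_comp_of_map_le hm hC hu).ae_memLp_prodMk hp hp'] with x hx
  exact hx.integrable hp

end Averages

/-! ### Functions with values in `L^p` as functions of two variables -/

section TwoVariables

variable {X Y : Type*} [MeasurableSpace X] [MeasurableSpace Y] {μ : Measure Y} {p : ℝ≥0∞}
  [hp : Fact (1 ≤ p)]

/-- A strongly measurable map to `L^p(Y)` has a jointly measurable representative. -/
theorem exists_measurable_uncurry_of_stronglyMeasurable {f : X → Lp ℝ p μ}
    (hf : StronglyMeasurable f) :
    ∃ F : X × Y → ℝ, Measurable F ∧ ∀ x, f x =ᵐ[μ] fun y => F (x, y) := by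
  classical
  obtain ⟨c, hc, hcf⟩ := hf.isSeparable_range
  obtain ⟨q, hq⟩ := (hc.insert 0).exists_eq_range (Set.insert_nonempty _ _)
  let e : ℕ → ℝ := fun n => (1 / 2 : ℝ) ^ n
  have he : ∀ n, 0 < e n := fun n => by positivity
  have hex : ∀ n x, ∃ j, dist (f x) (q j) < e n := by
    intro n x
    obtain ⟨b, hb, hb'⟩ := Metric.mem_closure_iff.1 (hcf ⟨x, rfl⟩) (e n) (he n)
    obtain ⟨j, hj⟩ : b ∈ Set.range q := hq ▸ Set.mem_insert_of_mem _ hb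
    exact ⟨j, hj ▸ hb'⟩
  -- `N n x` is the index of an element of the dense sequence at distance at most `2⁻ⁿ` of `f x`
  let N : ℕ → X → ℕ := fun n x => Nat.find (hex n x)
  have hN : ∀ n, Measurable (N n) := fun n => measurable_find (hex n) fun k =>
    (hf.dist stronglyMeasurable_const).measurable measurableSet_Iio
  have hNd : ∀ n x, dist (f x) (q (N n x)) < e n := fun n x => Nat.find_spec (hex n x)
  let F : ℕ → X × Y → ℝ := fun n z => q (N n z.1) z.2
  have hF : ∀ n, Measurable (F n) := by
    intro n
    have h1 : Measurable fun z : ℕ × Y => q z.1 z.2 :=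
      measurable_from_prod_countable_right fun k => (Lp.stronglyMeasurable (q k)).measurable
    exact h1.comp (((hN n).comp measurable_fst).prodMk measurable_snd)
  refine ⟨fun z => limsup (fun n => F n z) atTop, Measurable.limsup hF, fun x => ?_⟩
  -- the approximations converge at a summable rate, hence almost everywhere, and the limit is
  -- identified with `f x` through convergence in measure
  have hlim : ∀ᵐ y ∂μ, ∃ l, Tendsto (fun n => q (N n x) y) atTop (𝓝 l) := by
    refine Lp.ae_tendsto_of_cauchy_eLpNorm (B := fun n => ENNReal.ofReal (2 * e n))
      (fun n => Lp.aestronglyMeasurable _) hp.out ?_ ?_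
    · have hs : Summable fun n => 2 * e n := summable_geometric_two.mul_left 2
      rw [← ENNReal.ofReal_tsum_of_nonneg (fun n => by positivity) hs]
      exact ENNReal.ofReal_ne_top
    · intro M n m hn hm
      have hd : ∀ n, M ≤ n → dist (f x) (q (N n x)) < e M := fun n hn =>
        (hNd n x).trans_le (pow_le_pow_of_le_one (by norm_num) (by norm_num) hn)
      have : dist (q (N n x)) (q (N m x)) < 2 * e M := by
        have := dist_triangle_left (q (N n x)) (q (N m x)) (f x)
        linarith [hd n hn, hd m hm]
      rw [← Lp.edist_def, edist_dist]
      exact (ENNReal.ofReal_lt_ofReal_iff (by positivity)).2 this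
  have hm : TendstoInMeasure μ (fun n => (q (N n x) : Y → ℝ)) atTop (f x) := by
    refine tendstoInMeasure_of_tendsto_Lp (f := fun n => q (N n x)) ?_
    rw [tendsto_iff_dist_tendsto_zero]
    refine squeeze_zero (fun _ => dist_nonneg) (fun n => ?_)
      (tendsto_pow_atTop_nhds_zero_of_lt_one (r := (1 / 2 : ℝ)) (by norm_num) (by norm_num))
    rw [dist_comm]
    exact (hNd n x).le
  obtain ⟨ns, hns, hns'⟩ := hm.exists_seq_tendsto_ae
  filter_upwards [hlim, hns'] with y ⟨l, hl⟩ hy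
  have : f x y = l := tendsto_nhds_unique hy (hl.comp hns.tendsto_atTop)
  rw [this]
  exact hl.limsup_eq.symm

theorem integrableOn_Lp (v : Lp ℝ p μ) {s : Set Y} (hs : μ s ≠ ∞) : IntegrableOn v s μ := by
  have : IsFiniteMeasure (μ.restrict s) := ⟨by simpa using hs.lt_top⟩
  exact ((Lp.memLp v).restrict s).integrable hp.out

/-- The integral over a set of finite measure as a continuous linear form on `L^p`. -/
noncomputable def setIntegralLp (μ : Measure Y) (p : ℝ≥0∞) [hp : Fact (1 ≤ p)] {s : Set Y}
    (hs : μ s ≠ ∞) : Lp ℝ p μ →L[ℝ] ℝ :=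
  LinearMap.mkContinuous
    { toFun := fun v => ∫ y in s, v y ∂μ
      map_add' := fun v w => by
        rw [← integral_add (integrableOn_Lp v hs) (integrableOn_Lp w hs)]
        exact integral_congr_ae (ae_restrict_of_ae (Lp.coeFn_add v w))
      map_smul' := fun c v => by
        rw [RingHom.id_apply, ← integral_smul]
        exact integral_congr_ae (ae_restrict_of_ae (Lp.coeFn_smul c v)) }
    (μ s ^ (1 - 1 / p.toReal)).toReal (by
      intro v
      have : IsFiniteMeasure (μ.restrict s) := ⟨by simpa using hs.lt_top⟩
      have h := eLpNorm_le_eLpNorm_mul_rpow_measure_univ hp.out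
        (Lp.aestronglyMeasurable v).restrict (μ := μ.restrict s) (f := v)
      have h1 : ‖∫ y in s, v y ∂μ‖ₑ ≤ μ s ^ (1 - 1 / p.toReal) * eLpNorm v p μ := by
        refine (enorm_integral_le_lintegral_enorm _).trans ?_
        rw [← eLpNorm_one_eq_lintegral_enorm]
        refine h.trans ?_
        rw [ENNReal.toReal_one, div_one, Measure.restrict_apply_univ, mul_comm]
        exact mul_le_mul_right (eLpNorm_restrict_le _ _ _ _) _
      have hfin : μ s ^ (1 - 1 / p.toReal) ≠ ∞ := by
        refine ENNReal.rpow_ne_top_of_nonneg ?_ hs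
        by_cases hp' : p = ∞
        · simp [hp']
        · have : 1 ≤ p.toReal := by
            rw [← ENNReal.toReal_one]; exact ENNReal.toReal_mono hp' hp.out
          rw [sub_nonneg, div_le_one (by linarith)]
          exact this
      have h2 := ENNReal.toReal_mono (ENNReal.mul_ne_top hfin (Lp.memLp v).2.ne) h1
      rw [ENNReal.toReal_mul, toReal_enorm] at h2
      exact h2)

theorem setIntegralLp_apply {s : Set Y} (hs : μ s ≠ ∞) (v : Lp ℝ p μ) :
    setIntegralLp μ p hs v = ∫ y in s, v y ∂μ := rfl

theorem exists_setIntegral_norm_le {s : Set Y} (hs : μ s ≠ ∞) :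
    ∃ C : ℝ, ∀ v : Lp ℝ p μ, ∫ y in s, ‖v y‖ ∂μ ≤ C * ‖v‖ := by
  refine ⟨‖setIntegralLp μ p hs‖, fun v => ?_⟩
  have h : ∫ y in s, ‖v y‖ ∂μ = setIntegralLp μ p hs |v| := by
    rw [setIntegralLp_apply]
    refine integral_congr_ae (ae_restrict_of_ae ?_)
    filter_upwards [Lp.coeFn_abs v] with y hy
    rw [hy, Real.norm_eq_abs]
  rw [h]
  refine (le_abs_self _).trans (((setIntegralLp μ p hs).le_opNorm _).trans_eq ?_)
  rw [norm_abs_eq_norm]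

/-- The Bochner integral of an `L^p(Y)`-valued function is computed pointwise on `Y`. -/
theorem coeFn_integral_Lp [SigmaFinite μ] {ν : Measure X} [SFinite ν] {h : X → Lp ℝ p μ}
    (hh : Integrable h ν) {H : X × Y → ℝ} (hH : StronglyMeasurable H)
    (hhH : ∀ᵐ t ∂ν, h t =ᵐ[μ] fun y => H (t, y)) :
    (∫ t, h t ∂ν : Lp ℝ p μ) =ᵐ[μ] fun y => ∫ t, H (t, y) ∂ν := by
  have hint : ∀ s, μ s ≠ ∞ → Integrable H (ν.prod (μ.restrict s)) := by
    intro s hs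
    refine (integrable_prod_iff hH.aestronglyMeasurable).2 ⟨?_, ?_⟩
    · filter_upwards [hhH] with t ht
      exact (integrableOn_Lp (h t) hs).congr (ae_restrict_of_ae ht)
    · obtain ⟨C, hC⟩ := exists_setIntegral_norm_le (p := p) hs
      refine (hh.norm.const_mul C).mono' hH.norm.integral_prod_right'.aestronglyMeasurable ?_
      filter_upwards [hhH] with t ht
      rw [Real.norm_of_nonneg (integral_nonneg fun _ => norm_nonneg _)]
      refine le_trans (le_of_eq ?_) (hC (h t))
      refine integral_congr_ae (ae_restrict_of_ae ?_)
      filter_upwards [ht] with y hy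
      rw [hy]
  -- both sides have the same integral over every set of finite measure, by Fubini's theorem
  refine ae_eq_of_forall_setIntegral_eq_of_sigmaFinite (fun s _ hs => integrableOn_Lp _ hs.ne)
    (fun s _ hs => (hint s hs.ne).integral_prod_right) fun s hsm hs => ?_
  rw [← setIntegralLp_apply hs.ne, ← ContinuousLinearMap.integral_comp_comm _ hh,
    ← integral_integral_swap (f := fun t y => H (t, y)) (hint s hs.ne)]
  refine integral_congr_ae ?_
  filter_upwards [hhH] with t ht
  rw [setIntegralLp_apply]
  exact integral_congr_ae (ae_restrict_of_ae ht)

end TwoVariables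

/-! ### Finite products of measures -/

section Products

theorem lintegral_pi_succ {X : Type*} [MeasurableSpace X] (μ : Measure X) [SigmaFinite μ] (n : ℕ)
    {g : (Fin (n + 1) → X) → ℝ≥0∞} (hg : Measurable g) :
    ∫⁻ x, g x ∂(Measure.pi fun _ => μ) =
      ∫⁻ a, ∫⁻ y, g (Fin.cons a y) ∂(Measure.pi fun _ : Fin n => μ) ∂μ := by
  have e := (measurePreserving_piFinSuccAbove (fun _ : Fin (n + 1) => μ) 0).symm
  rw [← e.lintegral_comp hg]
  refine (lintegral_prod _ (hg.comp e.measurable).aemeasurable).trans ?_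
  simp only [Function.comp_apply, MeasurableEquiv.piFinSuccAbove_symm_apply,
    Fin.insertNthEquiv_zero]
  rfl

theorem lintegral_pi_prod {X : Type*} [MeasurableSpace X] (n : ℕ) (μ : Fin n → Measure X)
    [∀ i, SigmaFinite (μ i)] {f : X → ℝ≥0∞} (hf : Measurable f) :
    ∫⁻ x, ∏ i : Fin n, f (x i) ∂(Measure.pi μ) = ∏ i, ∫⁻ x, f x ∂(μ i) := by
  induction n with
  | zero => simp
  | succ n ih =>
    have e := (measurePreserving_piFinSuccAbove μ 0).symm
    have hm : Measurable fun x : Fin (n + 1) → X => ∏ i, f (x i) := by fun_prop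
    rw [← e.lintegral_comp hm]
    simp only [MeasurableEquiv.piFinSuccAbove_symm_apply, Fin.insertNthEquiv_zero,
      Fin.consEquiv_apply, Fin.prod_univ_succ, Fin.cons_zero, Fin.cons_succ, Fin.zero_succAbove]
    have hm' : Measurable fun x : Fin n → X => ∏ i, f (x i) := by fun_prop
    rw [← ih]
    exact lintegral_prod_mul hf.aemeasurable hm'.aemeasurable

theorem pi_withDensity {X : Type*} [MeasurableSpace X] (μ : Measure X) [SigmaFinite μ] (n : ℕ)
    {f : X → ℝ≥0∞} (hf : Measurable f) [SigmaFinite (μ.withDensity f)] :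
    Measure.pi (fun _ : Fin n => μ.withDensity f) =
      (Measure.pi fun _ : Fin n => μ).withDensity fun x => ∏ i, f (x i) := by
  refine Measure.pi_eq fun s hs => ?_
  rw [withDensity_apply _ (MeasurableSet.univ_pi hs), Measure.restrict_pi_pi,
    lintegral_pi_prod _ _ hf]
  exact Finset.prod_congr rfl fun i _ => (withDensity_apply _ (hs i)).symm

end Products

/-! ### Pushforward bounds from lower integrals -/

section MapBounds

variable {S T Y : Type*} [MeasurableSpace S] [MeasurableSpace T] [MeasurableSpace Y]
  {l : Measure S} [SFinite l] {ν : Measure T} [SFinite ν] {ρ : Measure Y}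

/-- A bound for the image of `l × ν` under `m`, given on lower integrals, restricts to a domain `D`
that `m` maps to `D'`. -/
theorem map_restrict_prod_le {m : S × T → Y} (hm : Measurable m) {C : ℝ≥0}
    (hC : ∀ g : Y → ℝ≥0∞, Measurable g → ∫⁻ x, ∫⁻ t, g (m (x, t)) ∂ν ∂l ≤ C * ∫⁻ y, g y ∂ρ)
    {D : Set S} {D' : Set Y} (hD : MeasurableSet D) (hD' : MeasurableSet D')
    (hDD' : ∀ x ∈ D, ∀ᵐ t ∂ν, m (x, t) ∈ D') :
    ((l.restrict D).prod ν).map m ≤ (C : ℝ≥0∞) • ρ.restrict D' := by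
  refine Measure.le_iff.2 fun A hA => ?_
  have hA' := hA.inter hD'
  have hg : Measurable ((A ∩ D').indicator (fun _ => (1 : ℝ≥0∞))) :=
    measurable_const.indicator hA'
  have h := hC _ hg
  rw [lintegral_indicator_const hA', one_mul] at h
  rw [Measure.map_apply hm hA, Measure.smul_apply, Measure.restrict_apply hA, smul_eq_mul]
  refine le_trans ?_ h
  rw [Measure.prod_apply (hm hA)]
  refine le_trans ?_ (setLIntegral_le_lintegral D _)
  refine setLIntegral_mono_ae' hD (Eventually.of_forall fun x hx => ?_)
  rw [← lintegral_indicator_one (measurable_prodMk_left (hm hA))]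
  refine lintegral_mono_ae ?_
  filter_upwards [hDD' x hx] with t ht
  by_cases h : m (x, t) ∈ A
  · rw [Set.indicator_of_mem (show m (x, t) ∈ A ∩ D' from ⟨h, ht⟩)]
    exact Set.indicator_le (fun _ _ => le_rfl) _
  · rw [Set.indicator_of_notMem (by exact h)]
    exact zero_le

theorem quasiMeasurePreserving_of_lintegral_le {m : S × T → Y} (hm : Measurable m) {C : ℝ≥0}
    (hC : ∀ g : Y → ℝ≥0∞, Measurable g → ∫⁻ x, ∫⁻ t, g (m (x, t)) ∂ν ∂l ≤ C * ∫⁻ y, g y ∂ρ) :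
    Measure.QuasiMeasurePreserving m (l.prod ν) ρ := by
  have h := map_restrict_prod_le hm hC MeasurableSet.univ MeasurableSet.univ (by simp)
  rw [Measure.restrict_univ, Measure.restrict_univ] at h
  exact ⟨hm, Measure.absolutelyContinuous_of_le_smul h⟩

end MapBounds

/-! ### Orbit maps -/

section Orbits

variable {Γ Z : Type*} [Group Γ] [MeasurableSpace Γ] [MeasurableInv Γ] [MulAction Γ Z]
  [MeasurableSpace Z] [MeasurableSMul₂ Γ Z] (μ : Measure Γ) [SFinite μ] (ρ : Measure Z)
  [SFinite ρ] [SMulInvariantMeasure Γ Z ρ]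

/-- Integration along the orbit map `(y, w) ↦ y w` in terms of the point `z = y w`. -/
theorem lintegral_lintegral_smul {K : Set Z} (hK : MeasurableSet K) {g : Z → ℝ≥0∞}
    (hg : Measurable g) :
    ∫⁻ y, ∫⁻ w in K, g (y • w) ∂ρ ∂μ = ∫⁻ z, μ {y | y⁻¹ • z ∈ K} * g z ∂ρ := by
  have hKm : MeasurableSet {q : Γ × Z | q.1⁻¹ • q.2 ∈ K} :=
    (show Measurable fun q : Γ × Z => q.1⁻¹ • q.2 by fun_prop) hK
  have hm : Measurable fun q : Γ × Z => {q : Γ × Z | q.1⁻¹ • q.2 ∈ K}.indicator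
      (fun q => g q.2) q := (hg.comp measurable_snd).indicator hKm
  calc ∫⁻ y, ∫⁻ w in K, g (y • w) ∂ρ ∂μ
      = ∫⁻ y, ∫⁻ z, {q : Γ × Z | q.1⁻¹ • q.2 ∈ K}.indicator (fun q => g q.2) (y, z) ∂ρ ∂μ := by
        refine lintegral_congr fun y => ?_
        have hy : Measurable fun z => {q : Γ × Z | q.1⁻¹ • q.2 ∈ K}.indicator
            (fun q => g q.2) (y, z) := hm.comp measurable_prodMk_left
        rw [← lintegral_indicator hK, ← (measurePreserving_smul y ρ).lintegral_comp hy]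
        refine lintegral_congr fun w => ?_
        by_cases hw : w ∈ K <;> simp [Set.indicator, hw]
    _ = ∫⁻ z, ∫⁻ y, {q : Γ × Z | q.1⁻¹ • q.2 ∈ K}.indicator (fun q => g q.2) (y, z) ∂μ ∂ρ :=
        lintegral_lintegral_swap hm.aemeasurable
    _ = ∫⁻ z, μ {y | y⁻¹ • z ∈ K} * g z ∂ρ := by
        refine lintegral_congr fun z => ?_
        rw [mul_comm]
        exact lintegral_indicator_const (measurable_prodMk_right hKm) (g z)

end Orbits

/-! ### The bump function and the averaging measure -/

section Group

variable {G : Type u} [Group G] [MetricSpace G] [IsTopologicalGroup G] [ProperSpace G]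
  [IsIsometricSMul G G] [MeasurableSpace G] [BorelSpace G]

/-- The continuous function `max 0 (1 - d(x, 1))`. -/
def tent (x : G) : ℝ := max 0 (1 - dist x 1)

theorem continuous_tent : Continuous (tent : G → ℝ) := by unfold tent; fun_prop

theorem tent_nonneg (x : G) : 0 ≤ tent x := le_max_left _ _

theorem tent_le_one (x : G) : tent x ≤ 1 :=
  max_le zero_le_one (by linarith [dist_nonneg (x := x) (y := 1)])

theorem tent_eq_zero {x : G} (hx : 1 ≤ dist x 1) : tent x = 0 := max_eq_left (by linarith)

theorem hasCompactSupport_tent : HasCompactSupport (tent : G → ℝ) :=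
  HasCompactSupport.intro (isCompact_closedBall (1 : G) 1) fun x hx =>
    tent_eq_zero (by rw [Metric.mem_closedBall, not_le] at hx; exact hx.le)

variable (μ : Measure G) [μ.IsHaarMeasure]

theorem integral_tent_pos : 0 < ∫ x, tent x ∂μ :=
  continuous_tent.integral_pos_of_hasCompactSupport_nonneg_nonzero hasCompactSupport_tent
    tent_nonneg (x := 1) (by simp [tent])

/-- A continuous probability density on `G`, supported in the closed unit ball around `1`. -/
noncomputable def bump (x : G) : ℝ := (∫ x, tent x ∂μ)⁻¹ * tent x

theorem continuous_bump : Continuous (bump μ) := continuous_tent.const_smul (∫ x, tent x ∂μ)⁻¹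

theorem bump_nonneg (x : G) : 0 ≤ bump μ x :=
  mul_nonneg (inv_nonneg.2 (integral_tent_pos μ).le) (tent_nonneg x)

theorem bump_eq_zero {x : G} (hx : 1 ≤ dist x 1) : bump μ x = 0 := by
  rw [bump, tent_eq_zero hx, mul_zero]

theorem exists_bump_le : ∃ M : ℝ≥0, ∀ x, bump μ x ≤ M :=
  ⟨(∫ x, tent x ∂μ)⁻¹.toNNReal, fun x => by
    rw [Real.coe_toNNReal _ (inv_nonneg.2 (integral_tent_pos μ).le)]
    exact mul_le_of_le_one_right (inv_nonneg.2 (integral_tent_pos μ).le) (tent_le_one x)⟩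

theorem integral_bump : ∫ x, bump μ x ∂μ = 1 := by
  simp only [bump]
  rw [integral_const_mul, inv_mul_cancel₀ (integral_tent_pos μ).ne']

/-- The probability measure on `G` with density `bump`. -/
noncomputable def bumpMeasure : Measure G := μ.withDensity fun x => ENNReal.ofReal (bump μ x)

theorem measurable_ofReal_bump : Measurable fun x => ENNReal.ofReal (bump μ x) :=
  (continuous_bump μ).measurable.ennreal_ofReal

instance : IsProbabilityMeasure (bumpMeasure μ) := by
  refine ⟨?_⟩
  rw [bumpMeasure, withDensity_apply _ MeasurableSet.univ, Measure.restrict_univ,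
    ← ofReal_integral_eq_lintegral_ofReal, integral_bump, ENNReal.ofReal_one]
  · have : HasCompactSupport (bump μ) := hasCompactSupport_tent.mul_left
    exact (continuous_bump μ).integrable_of_hasCompactSupport this
  · exact Eventually.of_forall (bump_nonneg μ)

/-- The product of `n` copies of the averaging measure. -/
noncomputable abbrev bumpPow (n : ℕ) : Measure (Fin n → G) := Measure.pi fun _ => bumpMeasure μ

theorem bumpPow_eq_withDensity (n : ℕ) :
    bumpPow μ n = (Measure.pi fun _ : Fin n => μ).withDensity
      fun t => ENNReal.ofReal (∏ i, bump μ (t i)) := by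
  have : SigmaFinite (μ.withDensity fun x => ENNReal.ofReal (bump μ x)) :=
    inferInstanceAs (SigmaFinite (bumpMeasure μ))
  refine (pi_withDensity μ n (measurable_ofReal_bump μ)).trans ?_
  congr 1
  ext t
  rw [ENNReal.ofReal_prod_of_nonneg fun i _ => bump_nonneg μ _]

theorem ae_bumpMeasure : ∀ᵐ t ∂bumpMeasure μ, dist t 1 ≤ 1 := by
  refine (ae_withDensity_iff (measurable_ofReal_bump μ)).2 (Eventually.of_forall fun t ht => ?_)
  by_contra! h
  exact ht (by rw [bump_eq_zero μ h.le, ENNReal.ofReal_zero])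

theorem ae_bumpPow (n : ℕ) : ∀ᵐ t ∂bumpPow μ n, ∀ i, dist (t i) 1 ≤ 1 :=
  eventually_all.2 fun i => (Measure.tendsto_eval_ae_ae (μ := fun _ : Fin n => bumpMeasure μ)
    (i := i)).eventually (ae_bumpMeasure μ)

/-- Forgetting a coordinate preserves the averaging measures. -/
theorem measurePreserving_removeNth_bumpPow (n : ℕ) (j : Fin (n + 1)) :
    MeasurePreserving (fun t : Fin (n + 1) → G => j.removeNth t) (bumpPow μ (n + 1))
      (bumpPow μ n) :=
  measurePreserving_snd.comp
    (measurePreserving_piFinSuccAbove (fun _ : Fin (n + 1) => bumpMeasure μ) j)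

theorem exists_lintegral_bumpPow_le (n : ℕ) : ∃ M : ℝ≥0, ∀ g : (Fin n → G) → ℝ≥0∞,
    ∫⁻ t, g t ∂bumpPow μ n ≤
      M * ∫⁻ t in Metric.closedBall 1 1, g t ∂(Measure.pi fun _ : Fin n => μ) := by
  obtain ⟨M, hM⟩ := exists_bump_le μ
  refine ⟨M ^ n, fun g => ?_⟩
  have hm : Measurable fun t : Fin n → G => ENNReal.ofReal (∏ i, bump μ (t i)) :=
    (Finset.measurable_prod _ fun i _ =>
      (continuous_bump μ).measurable.comp (measurable_pi_apply i)).ennreal_ofReal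
  have hfin : ∀ t : Fin n → G, ENNReal.ofReal (∏ i, bump μ (t i)) < ∞ :=
    fun t => ENNReal.ofReal_lt_top
  rw [bumpPow_eq_withDensity, lintegral_withDensity_eq_lintegral_mul_non_measurable _ hm
    (Eventually.of_forall hfin), ← lintegral_const_mul' _ _ ENNReal.coe_ne_top,
    ← lintegral_indicator Metric.isClosed_closedBall.measurableSet]
  refine lintegral_mono fun t => ?_
  rw [Pi.mul_apply]
  by_cases ht : t ∈ Metric.closedBall (1 : Fin n → G) 1
  · rw [Set.indicator_of_mem ht]
    refine mul_le_mul_left ?_ _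
    rw [← ENNReal.ofReal_coe_nnreal]
    refine ENNReal.ofReal_le_ofReal ?_
    push_cast
    refine (Finset.prod_le_prod (fun i _ => bump_nonneg μ _) fun i _ => hM (t i)).trans_eq ?_
    simp
  · rw [Set.indicator_of_notMem ht]
    rw [Metric.mem_closedBall, dist_pi_le_iff zero_le_one] at ht
    push Not at ht
    obtain ⟨i, hi⟩ := ht
    have hz : bump μ (t i) = 0 := bump_eq_zero μ hi.le
    rw [Finset.prod_eq_zero (Finset.mem_univ i) hz, ENNReal.ofReal_zero, zero_mul]

/-! ### Bounds for translations, prisms and orbits -/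

/-- The map `(z, t) ↦ z t` pushes the product measure to a multiple of Haar measure at most. No
unimodularity is needed, as `t` stays in a compact set. -/
theorem exists_lintegral_mul_le (n : ℕ) : ∃ C : ℝ≥0, ∀ g : (Fin n → G) → ℝ≥0∞, Measurable g →
    ∫⁻ z, ∫⁻ t, g (z * t) ∂bumpPow μ n ∂(Measure.pi fun _ => μ) ≤
      C * ∫⁻ z, g z ∂(Measure.pi fun _ => μ) := by
  obtain ⟨M, hM⟩ := exists_lintegral_bumpPow_le μ n
  let H : Measure (Fin n → G) := Measure.pi fun _ => μ
  let K : Set (Fin n → G) := Metric.closedBall 1 1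
  have hK : IsCompact K⁻¹ := (isCompact_closedBall _ _).inv
  refine ⟨M * (H K⁻¹).toNNReal, fun g hg => ?_⟩
  calc ∫⁻ z, ∫⁻ t, g (z * t) ∂bumpPow μ n ∂H ≤ ∫⁻ z, M * ∫⁻ t in K, g (z • t) ∂H ∂H :=
        lintegral_mono fun z => hM _
    _ = M * ∫⁻ z, H {y | y⁻¹ • z ∈ K} * g z ∂H := by
        rw [lintegral_const_mul' _ _ ENNReal.coe_ne_top,
          lintegral_lintegral_smul H H Metric.isClosed_closedBall.measurableSet hg]
    _ = M * ∫⁻ z, H K⁻¹ * g z ∂H := by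
        congr 1
        refine lintegral_congr fun z => ?_
        rw [← measure_preimage_mul H z⁻¹ K⁻¹]
        congr 2
        ext y
        simp [Set.mem_inv]
    _ = ((M * (H K⁻¹).toNNReal : ℝ≥0) : ℝ≥0∞) * ∫⁻ z, g z ∂H := by
        rw [lintegral_const_mul' _ _ hK.measure_lt_top.ne, ENNReal.coe_mul,
          ENNReal.coe_toNNReal hK.measure_lt_top.ne, mul_assoc]

theorem exists_lintegral_bumpMeasure_le : ∃ C : ℝ≥0, ∀ g : G → ℝ≥0∞, Measurable g → ∀ a : G,
    ∫⁻ b, g (a * b) ∂bumpMeasure μ ≤ C * ∫⁻ b, g b ∂μ := by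
  obtain ⟨M, hM⟩ := exists_bump_le μ
  refine ⟨M, fun g hg a => ?_⟩
  have hga : Measurable fun b => g (a * b) := hg.comp (measurable_const_mul a)
  rw [bumpMeasure, lintegral_withDensity_eq_lintegral_mul _ (measurable_ofReal_bump μ) hga,
    ← lintegral_mul_left_eq_self g a, ← lintegral_const_mul' _ _ ENNReal.coe_ne_top]
  refine lintegral_mono fun b => mul_le_mul_left ?_ _
  rw [← ENNReal.ofReal_coe_nnreal]
  exact ENNReal.ofReal_le_ofReal (hM b)

theorem measurable_finCons {X : Type*} [MeasurableSpace X] (n : ℕ) :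
    Measurable fun q : X × (Fin n → X) => (Fin.cons q.1 q.2 : Fin (n + 1) → X) := by
  refine measurable_pi_iff.2 fun j => ?_
  refine Fin.cases ?_ (fun j => ?_) j
  · exact measurable_fst
  · exact (measurable_pi_apply j).comp measurable_snd

theorem measurable_prism {X : Type*} [MeasurableSpace X] {n : ℕ} (i : Fin n) :
    Measurable fun q : (Fin n → X) × (Fin n → X) => prism i q.1 q.2 := by
  refine measurable_pi_iff.2 fun j => ?_
  unfold prism
  split_ifs <;> fun_prop

theorem cons_mul_cons {n : ℕ} (a b : G) (x y : Fin n → G) :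
    (Fin.cons a x * Fin.cons b y : Fin (n + 1) → G) = Fin.cons (a * b) (x * y) := by
  ext j
  refine Fin.cases ?_ (fun j => ?_) j <;> simp

/-- The maps `(z, t) ↦ (z₀, …, zᵢ, zᵢ tᵢ, …, z_{n-1} t_{n-1})` push the product measure to a
multiple of Haar measure at most. By induction, splitting off the first coordinate. -/
theorem exists_lintegral_prism_le {n : ℕ} (i : Fin n) :
    ∃ C : ℝ≥0, ∀ g : (Fin (n + 1) → G) → ℝ≥0∞, Measurable g →
      ∫⁻ z, ∫⁻ t, g (prism i z (z * t)) ∂bumpPow μ n ∂(Measure.pi fun _ => μ) ≤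
        C * ∫⁻ z, g z ∂(Measure.pi fun _ => μ) := by
  induction n with
  | zero => exact i.elim0
  | succ n ih =>
    have hpr : ∀ (i : Fin (n + 1)), Measurable fun q : (Fin (n + 1) → G) × (Fin (n + 1) → G) =>
        prism i q.1 (q.1 * q.2) := fun i =>
      (measurable_prism i).comp (measurable_fst.prodMk (measurable_fst.mul measurable_snd))
    have hsplit : ∀ g : (Fin (n + 2) → G) → ℝ≥0∞, Measurable g →
        ∫⁻ z, ∫⁻ t, g (prism i z (z * t)) ∂bumpPow μ (n + 1) ∂(Measure.pi fun _ => μ) =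
        ∫⁻ a, ∫⁻ y, ∫⁻ b, ∫⁻ s, g (prism i (Fin.cons a y) (Fin.cons (a * b) (y * s)))
          ∂bumpPow μ n ∂bumpMeasure μ ∂(Measure.pi fun _ => μ) ∂μ := by
      intro g hg
      rw [lintegral_pi_succ μ]
      · refine lintegral_congr fun a => lintegral_congr fun y => ?_
        rw [lintegral_pi_succ (bumpMeasure μ)]
        · simp only [cons_mul_cons]
        · exact hg.comp ((hpr i).comp measurable_prodMk_left)
      · exact Measurable.lintegral_prod_right'
          (f := fun q : (Fin (n + 1) → G) × (Fin (n + 1) → G) => g (prism i q.1 (q.1 * q.2)))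
          (hg.comp (hpr i))
    induction i using Fin.cases with
    | succ i =>
      -- for `i > 0` the variable `b` does not occur and integrates to one
      obtain ⟨C, hC⟩ := ih i
      refine ⟨C, fun g hg => ?_⟩
      rw [hsplit g hg]
      simp only [prism_succ, Fin.cons_zero, Fin.tail_cons]
      rw [lintegral_pi_succ μ _ hg]
      have hm : Measurable fun a => ∫⁻ y, g (Fin.cons a y) ∂(Measure.pi fun _ => μ) :=
        Measurable.lintegral_prod_right'
          (f := fun q : G × (Fin (n + 1) → G) => g (Fin.cons q.1 q.2))
          (hg.comp (measurable_finCons (n + 1)))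
      rw [← lintegral_const_mul' _ _ ENNReal.coe_ne_top]
      refine lintegral_mono fun a => ?_
      simp only [lintegral_const, measure_univ, mul_one]
      exact hC (fun w => g (Fin.cons a w))
        (hg.comp ((measurable_finCons (n + 1)).comp measurable_prodMk_left))
    | zero =>
      -- for `i = 0` the tuple is `(a, a b, y s)`, and the pairs `(a, b)` and `(y, s)` separate
      obtain ⟨C, hC⟩ := exists_lintegral_mul_le μ n
      obtain ⟨C', hC'⟩ := exists_lintegral_bumpMeasure_le μ
      refine ⟨C' * C, fun g hg => ?_⟩
      rw [hsplit g hg]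
      simp only [prism_zero, Fin.cons_zero]
      rw [lintegral_pi_succ μ _ hg, ← lintegral_const_mul' _ _ ENNReal.coe_ne_top]
      refine lintegral_mono fun a => ?_
      have hg₁ : Measurable fun q : G × (Fin n → G) =>
          g (Fin.cons a (Fin.cons q.1 q.2 : Fin (n + 1) → G)) :=
        hg.comp (((measurable_finCons (n + 1)).comp measurable_prodMk_left).comp
          (measurable_finCons n))
      have hsm : Measurable fun q : (Fin n → G) × (Fin n → G) => q.1 * q.2 :=
        measurable_fst.mul measurable_snd
      have hg₂ : Measurable fun q : ((Fin n → G) × G) × (Fin n → G) =>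
          g (Fin.cons a (Fin.cons (a * q.1.2) (q.1.1 * q.2) : Fin (n + 1) → G)) :=
        hg₁.comp ((measurable_fst.snd.const_mul a).prodMk
          (hsm.comp (measurable_fst.fst.prodMk measurable_snd)))
      have hg₃ : Measurable fun b => ∫⁻ y, g (Fin.cons a (Fin.cons b y : Fin (n + 1) → G))
          ∂(Measure.pi fun _ => μ) := hg₁.lintegral_prod_right'
      have hg₄ : Measurable fun y : Fin (n + 1) → G => g (Fin.cons a y) :=
        hg.comp ((measurable_finCons (n + 1)).comp measurable_prodMk_left)
      rw [lintegral_lintegral_swap hg₂.lintegral_prod_right'.aemeasurable,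
        lintegral_pi_succ μ _ hg₄]
      calc ∫⁻ b, ∫⁻ y, ∫⁻ s, g (Fin.cons a (Fin.cons (a * b) (y * s) : Fin (n + 1) → G))
            ∂bumpPow μ n ∂(Measure.pi fun _ => μ) ∂bumpMeasure μ
          ≤ ∫⁻ b, C * ∫⁻ y, g (Fin.cons a (Fin.cons (a * b) y : Fin (n + 1) → G))
              ∂(Measure.pi fun _ => μ) ∂bumpMeasure μ :=
            lintegral_mono fun b => hC _ (hg₁.comp measurable_prodMk_left)
        _ = C * ∫⁻ b, ∫⁻ y, g (Fin.cons a (Fin.cons (a * b) y : Fin (n + 1) → G))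
              ∂(Measure.pi fun _ => μ) ∂bumpMeasure μ :=
            lintegral_const_mul' _ _ ENNReal.coe_ne_top
        _ ≤ C * (C' * ∫⁻ b, ∫⁻ y, g (Fin.cons a (Fin.cons b y : Fin (n + 1) → G))
              ∂(Measure.pi fun _ => μ) ∂μ) := mul_le_mul_right (hC' _ hg₃ a) _
        _ = _ := by push_cast; ring

instance smulInvariantMeasure_powMeasure (k : ℕ) :
    SMulInvariantMeasure G (Fin (k + 1) → G) (powMeasure μ k) :=
  ⟨fun c _ _ => measure_preimage_mul (powMeasure μ k) (fun _ => c) _⟩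

theorem dist_inv_mul_one (y z : G) : dist (y⁻¹ * z) 1 = dist z y := by
  rw [← dist_mul_left y, mul_inv_cancel_left, mul_one]

/-- The orbit map `(y, w) ↦ y w`, for `w` in a ball, pushes the product measure to at most a
multiple of Haar measure: for a given `z`, the `y` such that `y⁻¹ z` is in the ball lie in a ball
around `z₀`. -/
theorem exists_lintegral_smul_le (k : ℕ) (r : ℝ) :
    ∃ C : ℝ≥0, ∀ g : (Fin (k + 1) → G) → ℝ≥0∞, Measurable g →
      ∫⁻ y, ∫⁻ w in Metric.closedBall 1 r, g (y • w) ∂powMeasure μ k ∂μ ≤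
        C * ∫⁻ z, g z ∂powMeasure μ k := by
  refine ⟨(μ (Metric.closedBall 1 r)).toNNReal, fun g hg => ?_⟩
  rw [lintegral_lintegral_smul μ _ Metric.isClosed_closedBall.measurableSet hg,
    ENNReal.coe_toNNReal measure_closedBall_lt_top.ne,
    ← lintegral_const_mul' _ _ measure_closedBall_lt_top.ne]
  refine lintegral_mono fun z => mul_le_mul_left ?_ _
  rw [← measure_preimage_mul μ (z 0)⁻¹ (Metric.closedBall 1 r)]
  refine measure_mono fun y hy => ?_
  have h : dist ((y⁻¹ • z) 0) 1 ≤ r := (dist_le_pi_dist _ _ 0).trans hy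
  rw [Pi.smul_apply, smul_eq_mul, dist_inv_mul_one] at h
  rw [Set.mem_preimage, Metric.mem_closedBall, dist_inv_mul_one, dist_comm]
  exact h

/-- A lower bound for the pushforward under the orbit map on `Δ_s`: a point of `Δ_s` is `y w` with
`w` in the ball of radius `s + 1` for all `y` in a unit ball. -/
theorem exists_le_lintegral_smul (k : ℕ) {s : ℝ} :
    ∃ C : ℝ≥0, ∀ g : (Fin (k + 1) → G) → ℝ≥0∞, Measurable g →
      ∫⁻ z in diagNhd G k s, g z ∂powMeasure μ k ≤
        C * ∫⁻ y, ∫⁻ w in Metric.closedBall 1 (s + 1), g (y • w) ∂powMeasure μ k ∂μ := by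
  have hpos : μ (Metric.ball (1 : G) 1) ≠ 0 := (Metric.measure_ball_pos μ 1 one_pos).ne'
  have hfin : μ (Metric.ball (1 : G) 1) ≠ ∞ := measure_ball_lt_top.ne
  refine ⟨((μ (Metric.ball 1 1))⁻¹).toNNReal, fun g hg => ?_⟩
  rw [lintegral_lintegral_smul μ _ Metric.isClosed_closedBall.measurableSet hg,
    ENNReal.coe_toNNReal (ENNReal.inv_ne_top.2 hpos),
    ← lintegral_const_mul' _ _ (ENNReal.inv_ne_top.2 hpos),
    ← lintegral_indicator (isClosed_diagNhd k s).measurableSet]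
  refine lintegral_mono fun z => ?_
  by_cases hz : z ∈ diagNhd G k s
  · rw [Set.indicator_of_mem hz, ← mul_assoc]
    refine le_mul_of_one_le_left' ?_
    rw [← ENNReal.inv_mul_cancel hpos hfin]
    refine mul_le_mul_right ?_ _
    rw [← measure_preimage_mul μ (z 0)⁻¹ (Metric.ball 1 1)]
    refine measure_mono fun y hy => ?_
    rw [Set.mem_preimage, Metric.mem_ball, dist_inv_mul_one] at hy
    have hs : 0 ≤ s := dist_nonneg.trans (hz 0 0)
    refine (dist_pi_le_iff (by linarith)).2 fun i => ?_
    rw [Pi.smul_apply, smul_eq_mul, Pi.one_apply, dist_inv_mul_one]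
    linarith [dist_triangle (z i) (z 0) y, hz i 0, dist_comm (z 0) y]
  · rw [Set.indicator_of_notMem hz]
    exact zero_le

end Group

/-! ### Averaging operators on the asymptotic complex -/

section Averaging

variable {G : Type u} [Group G] [MetricSpace G] [IsTopologicalGroup G] [ProperSpace G]
  [IsIsometricSMul G G] [MeasurableSpace G] [BorelSpace G] (μ : Measure G) [μ.IsHaarMeasure]

/-- A map `m` sending a `(k+1)`-tuple `z` and a parameter `t` to an `(l+1)`-tuple, such that the
operator `u ↦ ∫ u(m(·, t)) dt` (for the averaging measure) is bounded from `AS^{l,p}` to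
`AS^{k,p}` for all `p`. -/
structure Admissible {k l n : ℕ} (m : (Fin (k + 1) → G) × (Fin n → G) → (Fin (l + 1) → G)) :
    Prop where
  measurable : Measurable m
  lintegral_le : ∃ C : ℝ≥0, ∀ g : (Fin (l + 1) → G) → ℝ≥0∞, Measurable g →
    ∫⁻ z, ∫⁻ t, g (m (z, t)) ∂bumpPow μ n ∂powMeasure μ k ≤ C * ∫⁻ z, g z ∂powMeasure μ l
  mem_diagNhd : ∀ s : ℝ, 0 < s → ∃ s' : ℝ, 0 < s' ∧ ∀ z ∈ diagNhd G k s,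
    ∀ᵐ t ∂bumpPow μ n, m (z, t) ∈ diagNhd G l s'

theorem admissible_mul (k : ℕ) : Admissible μ
    fun q : (Fin (k + 1) → G) × (Fin (k + 1) → G) => q.1 * q.2 where
  measurable := measurable_fst.mul measurable_snd
  lintegral_le := exists_lintegral_mul_le μ (k + 1)
  mem_diagNhd s hs := by
    refine ⟨s + 2, by linarith, fun z hz => ?_⟩
    filter_upwards [ae_bumpPow μ (k + 1)] with t ht i j
    have h : ∀ i, dist ((z * t) i) (z i) ≤ 1 := fun i => by
      have := dist_mul_left (z i) (t i) 1
      rw [mul_one] at this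
      exact this.trans_le (ht i)
    have := dist_triangle4 ((z * t) i) (z i) (z j) ((z * t) j)
    linarith [h i, h j, hz i j, dist_comm (z j) ((z * t) j)]

theorem admissible_prism (k : ℕ) (i : Fin (k + 1)) : Admissible μ
    fun q : (Fin (k + 1) → G) × (Fin (k + 1) → G) => prism i q.1 (q.1 * q.2) where
  measurable := (measurable_prism i).comp
    (measurable_fst.prodMk (measurable_fst.mul measurable_snd))
  lintegral_le := exists_lintegral_prism_le μ i
  mem_diagNhd s hs := by
    refine ⟨s + 2, by linarith, fun z hz => ?_⟩
    filter_upwards [ae_bumpPow μ (k + 1)] with t ht a b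
    have h : ∀ j, dist (prism i z (z * t) j) (z (i.predAbove j)) ≤ 1 := fun j => by
      unfold prism
      split_ifs
      · rw [dist_self]; exact zero_le_one
      · have := dist_mul_left (z (i.predAbove j)) (t (i.predAbove j)) 1
        rw [mul_one] at this
        exact this.trans_le (ht _)
    have := dist_triangle4 (prism i z (z * t) a) (z (i.predAbove a)) (z (i.predAbove b))
      (prism i z (z * t) b)
    linarith [h a, h b, hz (i.predAbove a) (i.predAbove b),
      dist_comm (z (i.predAbove b)) (prism i z (z * t) b)]

theorem ae_of_ae_restrict_diagNhd {k : ℕ} {P : (Fin (k + 1) → G) → Prop}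
    (h : ∀ s : ℝ, 0 < s → ∀ᵐ z ∂(powMeasure μ k).restrict (diagNhd G k s), P z) :
    ∀ᵐ z ∂powMeasure μ k, P z := by
  have h0 : ∀ n : ℕ, ∀ᵐ z ∂powMeasure μ k, z ∈ diagNhd G k (n + 1 : ℝ) → P z := fun n =>
    (ae_restrict_iff' (isClosed_diagNhd k _).measurableSet).1 (h _ (by positivity))
  filter_upwards [ae_all_iff.2 h0] with z hz
  obtain ⟨n, hn⟩ := exists_nat_ge (Metric.diam (Set.range z))
  refine hz n fun i j => ?_
  have := Metric.dist_le_diam_of_mem (Set.finite_range z).isBounded ⟨i, rfl⟩ ⟨j, rfl⟩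
  linarith

variable {μ}

/-- The function `w` is almost everywhere the average `∫ H(z, t) dt` of `H` for the averaging
measure, the integrals being convergent. -/
def IsAvg (μ : Measure G) [μ.IsHaarMeasure] {k n : ℕ} (w : (Fin (k + 1) → G) → ℝ)
    (H : (Fin (k + 1) → G) → (Fin n → G) → ℝ) : Prop :=
  ∀ᵐ z ∂powMeasure μ k, Integrable (H z) (bumpPow μ n) ∧ w z = ∫ t, H z t ∂bumpPow μ n

namespace IsAvg

variable {k n : ℕ} {w w' : (Fin (k + 1) → G) → ℝ} {H H' : (Fin (k + 1) → G) → (Fin n → G) → ℝ}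

theorem ae_eq (h : IsAvg μ w H) (h' : IsAvg μ w' H) : w =ᵐ[powMeasure μ k] w' := by
  filter_upwards [h, h'] with z hz hz'
  rw [hz.2, hz'.2]

theorem congr (h : IsAvg μ w H) (hw : w' =ᵐ[powMeasure μ k] w) : IsAvg μ w' H := by
  filter_upwards [h, hw] with z hz hz'
  exact ⟨hz.1, hz'.trans hz.2⟩

theorem congr_right (h : IsAvg μ w H) (hH : ∀ z t, H' z t = H z t) : IsAvg μ w H' := by
  have e : H' = H := funext₂ hH
  rwa [e]

theorem self (w : (Fin (k + 1) → G) → ℝ) : IsAvg μ w fun z (_ : Fin n → G) => w z :=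
  Eventually.of_forall fun z => ⟨integrable_const _, by simp⟩

theorem sub (h : IsAvg μ w H) (h' : IsAvg μ w' H') :
    IsAvg μ (fun z => w z - w' z) fun z t => H z t - H' z t := by
  filter_upwards [h, h'] with z hz hz'
  exact ⟨hz.1.sub hz'.1, by rw [integral_sub hz.1 hz'.1, hz.2, hz'.2]⟩

theorem add (h : IsAvg μ w H) (h' : IsAvg μ w' H') :
    IsAvg μ (fun z => w z + w' z) fun z t => H z t + H' z t := by
  filter_upwards [h, h'] with z hz hz'
  exact ⟨hz.1.add hz'.1, by rw [integral_add hz.1 hz'.1, hz.2, hz'.2]⟩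

theorem neg (h : IsAvg μ w H) : IsAvg μ (fun z => -w z) fun z t => -H z t := by
  filter_upwards [h] with z hz
  exact ⟨hz.1.neg, by rw [integral_neg, hz.2]⟩

theorem sum_smul {ι : Type*} [Fintype ι] (c : ι → ℝ) {w : ι → (Fin (k + 1) → G) → ℝ}
    {H : ι → (Fin (k + 1) → G) → (Fin n → G) → ℝ} (h : ∀ i, IsAvg μ (w i) (H i)) :
    IsAvg μ (fun z => ∑ i, c i • w i z) fun z t => ∑ i, c i • H i z t := by
  filter_upwards [ae_all_iff.2 h] with z hz
  refine ⟨integrable_finsetSum _ fun i _ => (hz i).1.smul (c i), ?_⟩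
  refine Eq.trans ?_ (integral_finsetSum _ fun i _ => (hz i).1.smul (c i)).symm
  exact Finset.sum_congr rfl fun i _ => by
    rw [(hz i).2, ← integral_smul]
    rfl

theorem removeNth {w : (Fin (k + 1) → G) → ℝ} (h : IsAvg μ w H) (j : Fin (k + 2))
    (j' : Fin (n + 1)) :
    IsAvg μ (fun z => w (j.removeNth z)) fun z t => H (j.removeNth z) (j'.removeNth t) := by
  filter_upwards [(quasiMeasurePreserving_removeNth μ k j).ae h] with z hz
  have hp := measurePreserving_removeNth_bumpPow μ n j'
  refine ⟨hp.integrable_comp_of_integrable hz.1, ?_⟩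
  rw [hz.2, ← hp.map_eq]
  refine integral_map hp.measurable.aemeasurable ?_
  rw [hp.map_eq]
  exact hz.1.1

end IsAvg

variable {p : ℝ≥0∞} [hp : Fact (1 ≤ p)] (hp' : p ≠ ∞)

namespace Admissible

variable {k l n : ℕ} {m : (Fin (k + 1) → G) × (Fin n → G) → (Fin (l + 1) → G)}

theorem quasiMeasurePreserving (hm : Admissible μ m) :
    Measure.QuasiMeasurePreserving m ((powMeasure μ k).prod (bumpPow μ n)) (powMeasure μ l) :=
  let ⟨_, hC⟩ := hm.lintegral_le
  quasiMeasurePreserving_of_lintegral_le hm.measurable hC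

theorem exists_map_le (hm : Admissible μ m) (s : ℝ) (hs : 0 < s) : ∃ s' : ℝ, 0 < s' ∧ ∃ C : ℝ≥0,
    (((powMeasure μ k).restrict (diagNhd G k s)).prod (bumpPow μ n)).map m ≤
      (C : ℝ≥0∞) • (powMeasure μ l).restrict (diagNhd G l s') := by
  obtain ⟨C, hC⟩ := hm.lintegral_le
  obtain ⟨s', hs', h⟩ := hm.mem_diagNhd s hs
  exact ⟨s', hs', C, map_restrict_prod_le hm.measurable hC (isClosed_diagNhd k s).measurableSet
    (isClosed_diagNhd l s').measurableSet h⟩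

include hp' in
theorem isAvg (hm : Admissible μ m) {u : (Fin (l + 1) → G) →ₘ[powMeasure μ l] ℝ}
    (hu : u ∈ asSubmodule μ p l) :
    IsAvg μ (fun z => ∫ t, u (m (z, t)) ∂bumpPow μ n) fun z t => u (m (z, t)) := by
  refine ae_of_ae_restrict_diagNhd μ fun s hs => ?_
  obtain ⟨s', hs', C, hC⟩ := hm.exists_map_le s hs
  filter_upwards [ae_integrable_comp_of_map_le hp.out hp' hm.measurable hC (hu s' hs')] with z hz
  exact ⟨hz, rfl⟩

theorem stronglyMeasurable_integral (hm : Admissible μ m)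
    (u : (Fin (l + 1) → G) →ₘ[powMeasure μ l] ℝ) :
    StronglyMeasurable fun z => ∫ t, u (m (z, t)) ∂bumpPow μ n :=
  (u.stronglyMeasurable.comp_measurable hm.measurable).integral_prod_right'

include hp' in
theorem exists_eLpNorm_le (hm : Admissible μ m) (s : ℝ) (hs : 0 < s) : ∃ s' : ℝ, 0 < s' ∧
    ∃ C : ℝ≥0, ∀ u ∈ asSubmodule μ p l,
      eLpNorm (fun z => ∫ t, u (m (z, t)) ∂bumpPow μ n) p
        ((powMeasure μ k).restrict (diagNhd G k s)) ≤
        C * eLpNorm u p ((powMeasure μ l).restrict (diagNhd G l s')) := by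
  obtain ⟨s', hs', C, hC⟩ := hm.exists_map_le s hs
  refine ⟨s', hs', C ^ (1 / p).toReal, fun u hu => ?_⟩
  have h := eLpNorm_integral_comp_le hp.out hp' hm.measurable hC (a := fun _ => 1) (M := 1)
    (by simp) (hu s' hs')
  simp only [one_mul, measure_univ, ENNReal.one_rpow, ENNReal.coe_one] at h
  rw [ENNReal.coe_rpow_of_nonneg _ ENNReal.toReal_nonneg]
  exact h

/-- The averaging operator `u ↦ ∫ u(m(·, t)) dt` from `AS^{l,p}(G)` to `AS^{k,p}(G)`, as a linear
map. -/
noncomputable def avgLinearMap (hp' : p ≠ ∞) (hm : Admissible μ m) :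
    ASpace μ p l →ₗ[ℝ] ASpace μ p k where
  toFun u := ⟨AEEqFun.mk _ (hm.stronglyMeasurable_integral u.1).aestronglyMeasurable,
    fun s hs => by
      obtain ⟨s', hs', C, hC⟩ := hm.exists_eLpNorm_le hp' s hs
      refine (memLp_congr_ae (ae_restrict_of_ae (AEEqFun.coeFn_mk _ _))).2
        ⟨(hm.stronglyMeasurable_integral u.1).aestronglyMeasurable, (hC u u.2).trans_lt ?_⟩
      exact ENNReal.mul_lt_top ENNReal.coe_lt_top (u.2 s' hs').2⟩
  map_add' u v := by
    refine Subtype.ext (AEEqFun.ext ?_)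
    have h₁ := hm.quasiMeasurePreserving.ae (AEEqFun.coeFn_add u.1 v.1)
    filter_upwards [hm.isAvg hp' u.2, hm.isAvg hp' v.2, Measure.ae_ae_of_ae_prod h₁,
      AEEqFun.coeFn_mk _ (hm.stronglyMeasurable_integral (u + v).1).aestronglyMeasurable,
      AEEqFun.coeFn_mk _ (hm.stronglyMeasurable_integral u.1).aestronglyMeasurable,
      AEEqFun.coeFn_mk _ (hm.stronglyMeasurable_integral v.1).aestronglyMeasurable,
      AEEqFun.coeFn_add (AEEqFun.mk _ (hm.stronglyMeasurable_integral u.1).aestronglyMeasurable)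
        (AEEqFun.mk _ (hm.stronglyMeasurable_integral v.1).aestronglyMeasurable)]
      with z hu hv h₁ h₂ h₃ h₄ h₅
    refine h₂.trans (Eq.trans ?_ h₅.symm)
    rw [Pi.add_apply, h₃, h₄, ← integral_add hu.1 hv.1]
    exact integral_congr_ae h₁
  map_smul' c u := by
    refine Subtype.ext (AEEqFun.ext ?_)
    have h₁ := hm.quasiMeasurePreserving.ae (AEEqFun.coeFn_smul c u.1)
    filter_upwards [Measure.ae_ae_of_ae_prod h₁,
      AEEqFun.coeFn_mk _ (hm.stronglyMeasurable_integral (c • u).1).aestronglyMeasurable,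
      AEEqFun.coeFn_mk _ (hm.stronglyMeasurable_integral u.1).aestronglyMeasurable,
      AEEqFun.coeFn_smul c
        (AEEqFun.mk _ (hm.stronglyMeasurable_integral u.1).aestronglyMeasurable)]
      with z h₁ h₂ h₃ h₄
    refine h₂.trans (Eq.trans ?_ h₄.symm)
    rw [Pi.smul_apply, h₃, ← integral_smul]
    exact integral_congr_ae h₁

/-- The averaging operator `u ↦ ∫ u(m(·, t)) dt` from `AS^{l,p}(G)` to `AS^{k,p}(G)`. -/
noncomputable def avg (hp' : p ≠ ∞) (hm : Admissible μ m) : ASpace μ p l →L[ℝ] ASpace μ p k where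
  toLinearMap := hm.avgLinearMap hp'
  cont := by
    refine WithSeminorms.continuous_of_isBounded (asWithSeminorms μ p l)
      (asWithSeminorms μ p k) _ fun s => ?_
    obtain ⟨s', hs', C, hC⟩ := hm.exists_eLpNorm_le hp' s.1 s.2
    refine ⟨{⟨s', hs'⟩}, C, fun u => ?_⟩
    have h := ENNReal.toReal_mono (ENNReal.mul_ne_top ENNReal.coe_ne_top (u.2 s' hs').2.ne)
      (hC u.1 u.2)
    rw [ENNReal.toReal_mul, ← eLpNorm_congr_ae (ae_restrict_of_ae (AEEqFun.coeFn_mk _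
      (hm.stronglyMeasurable_integral u.1).aestronglyMeasurable))] at h
    rw [Finset.sup_singleton]
    exact h

theorem coeFn_avg (hm : Admissible μ m) (u : ASpace μ p l) :
    (hm.avg hp' u).1 =ᵐ[powMeasure μ k] fun z => ∫ t, u.1 (m (z, t)) ∂bumpPow μ n :=
  AEEqFun.coeFn_mk _ _

theorem isAvg_avg (hm : Admissible μ m) (u : ASpace μ p l) {V : (Fin (l + 1) → G) → ℝ}
    (hV : u.1 =ᵐ[powMeasure μ l] V) : IsAvg μ (hm.avg hp' u).1 fun z t => V (m (z, t)) := by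
  filter_upwards [(hm.isAvg hp' u.2).congr (hm.coeFn_avg hp' u),
    Measure.ae_ae_of_ae_prod (hm.quasiMeasurePreserving.ae hV)] with z hz hz'
  exact ⟨hz.1.congr hz', hz.2.trans (integral_congr_ae hz')⟩

end Admissible

theorem coeFn_sum_smul {k : ℕ} {ι : Type*} (s : Finset ι) (c : ι → ℝ) (w : ι → ASpace μ p k) :
    (∑ i ∈ s, c i • w i : ASpace μ p k).1 =ᵐ[powMeasure μ k]
      fun z => ∑ i ∈ s, c i • (w i).1 z := by
  classical
  induction s using Finset.induction_on with
  | empty => exact AEEqFun.coeFn_zero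
  | insert a s ha ih =>
    rw [Finset.sum_insert ha]
    filter_upwards [ih, AEEqFun.coeFn_add (c a • (w a).1) (∑ i ∈ s, c i • w i : ASpace μ p k).1,
      AEEqFun.coeFn_smul (c a) (w a).1] with z h₁ h₂ h₃
    rw [Finset.sum_insert ha, ← h₁]
    refine h₂.trans ?_
    rw [Pi.add_apply, h₃, Pi.smul_apply]

theorem coeFn_asD {k : ℕ} (u : ASpace μ p k) :
    (asD μ p k u).1 =ᵐ[powMeasure μ (k + 1)] altSum u.1 := by
  rw [asD_apply]
  filter_upwards [coeFn_sum_smul Finset.univ (fun i : Fin (k + 2) => (-1 : ℝ) ^ (i : ℕ))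
    (fun i => asFace μ p k i u), ae_all_iff.2 fun i => coeFn_aeFace μ k i u.1] with z h₁ h₂
  rw [h₁]
  exact Finset.sum_congr rfl fun i _ => by rw [← h₂ i]; rfl

variable (μ)

/-- The regularization operator `(R u)(z) = ∫ u(z₀ t₀, …, z_k t_k) dt` of `AS^{k,p}(G)`. -/
noncomputable def asReg (k : ℕ) : ASpace μ p k →L[ℝ] ASpace μ p k := (admissible_mul μ k).avg hp'

/-- The homotopy
`(β u)(z) = -∑ᵢ (-1)ⁱ ∫ u(z₀, …, zᵢ, zᵢ tᵢ, …, z_k t_k) dt` between the identity and the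
regularization operator. -/
noncomputable def asHtpy (k : ℕ) : ASpace μ p (k + 1) →L[ℝ] ASpace μ p k :=
  -∑ i : Fin (k + 1), (-1 : ℝ) ^ (i : ℕ) • (admissible_prism μ k i).avg hp'

variable {μ}

theorem isAvg_asReg {k : ℕ} (u : ASpace μ p k) {V : (Fin (k + 1) → G) → ℝ}
    (hV : u.1 =ᵐ[powMeasure μ k] V) :
    IsAvg μ (asReg μ hp' k u).1 fun z (t : Fin (k + 1) → G) => V (z * t) :=
  (admissible_mul μ k).isAvg_avg hp' u hV

theorem isAvg_asHtpy {k : ℕ} (u : ASpace μ p (k + 1)) {V : (Fin (k + 2) → G) → ℝ}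
    (hV : u.1 =ᵐ[powMeasure μ (k + 1)] V) :
    IsAvg μ (asHtpy μ hp' k u).1 fun z (t : Fin (k + 1) → G) => -prismSum V z (z * t) := by
  refine (IsAvg.sum_smul (fun i : Fin (k + 1) => (-1 : ℝ) ^ (i : ℕ)) fun i =>
    (admissible_prism μ k i).isAvg_avg hp' u hV).neg.congr ?_
  have e : asHtpy μ hp' k u = -∑ i : Fin (k + 1), (-1 : ℝ) ^ (i : ℕ) •
      (admissible_prism μ k i).avg hp' u := by
    simp [asHtpy]
  rw [e]
  filter_upwards [coeFn_sum_smul Finset.univ (fun i : Fin (k + 1) => (-1 : ℝ) ^ (i : ℕ))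
    (fun i => (admissible_prism μ k i).avg hp' u),
    AEEqFun.coeFn_neg (∑ i : Fin (k + 1), (-1 : ℝ) ^ (i : ℕ) •
      (admissible_prism μ k i).avg hp' u : ASpace μ p k).1] with z h₁ h₂
  refine h₂.trans ?_
  rw [Pi.neg_apply, h₁]

theorem isAvg_asD {k n : ℕ} {w : ASpace μ p k} {H : (Fin (k + 1) → G) → (Fin n → G) → ℝ}
    (h : IsAvg μ w.1 H) (j' : Fin (k + 2) → Fin (n + 1)) :
    IsAvg μ (asD μ p k w).1 fun z t =>
      ∑ j : Fin (k + 2), (-1 : ℝ) ^ (j : ℕ) • H (j.removeNth z) ((j' j).removeNth t) :=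
  (IsAvg.sum_smul (fun j : Fin (k + 2) => (-1 : ℝ) ^ (j : ℕ)) fun j =>
    h.removeNth j (j' j)).congr (coeFn_asD w)

theorem asReg_asD (k : ℕ) (u : ASpace μ p k) :
    asReg μ hp' (k + 1) (asD μ p k u) = asD μ p k (asReg μ hp' k u) :=
  Subtype.ext (AEEqFun.ext ((isAvg_asReg hp' _ (coeFn_asD u)).ae_eq
    (isAvg_asD (isAvg_asReg hp' u .rfl) id)))

theorem asHtpy_zero (u : ASpace μ p 0) :
    asHtpy μ hp' 0 (asD μ p 0 u) = u - asReg μ hp' 0 u := by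
  refine Subtype.ext (AEEqFun.ext ?_)
  refine ((isAvg_asHtpy hp' _ (coeFn_asD u)).congr_right fun z t => ?_).ae_eq
    (((IsAvg.self u.1).sub (isAvg_asReg hp' u .rfl)).congr
      (AEEqFun.coeFn_sub u.1 (asReg μ hp' 0 u).1))
  have := prismSum_removeNth_add_prismSum_altSum (n := 0) (u.1 : (Fin 1 → G) → ℝ) z (z * t)
  rw [← neg_sub (u.1 (z * t)), ← this, neg_inj]
  simp [prismSum]

theorem asHtpy_succ (k : ℕ) (u : ASpace μ p (k + 1)) :
    asD μ p k (asHtpy μ hp' k u) + asHtpy μ hp' (k + 1) (asD μ p (k + 1) u) =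
      u - asReg μ hp' (k + 1) u := by
  refine Subtype.ext (AEEqFun.ext ?_)
  refine ((((isAvg_asD (isAvg_asHtpy hp' u .rfl) id).add
    (isAvg_asHtpy hp' _ (coeFn_asD u))).congr (AEEqFun.coeFn_add _ _)).congr_right
      fun z t => ?_).ae_eq (((IsAvg.self u.1).sub (isAvg_asReg hp' u .rfl)).congr
        (AEEqFun.coeFn_sub u.1 (asReg μ hp' (k + 1) u).1))
  have := prismSum_removeNth_add_prismSum_altSum (u.1 : (Fin (k + 2) → G) → ℝ) z (z * t)
  rw [← neg_sub (u.1 (z * t)), ← this, neg_add, ← Finset.sum_neg_distrib]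
  simp only [smul_neg]
  rfl

end Averaging

/-! ### Invariant `L^p`-valued functions as scalar functions -/

section Representation

variable {G : Type u} [Group G] [MetricSpace G] [IsTopologicalGroup G] [ProperSpace G]
  [IsIsometricSMul G G] [MeasurableSpace G] [BorelSpace G] {μ : Measure G} [μ.IsHaarMeasure]
  {p : ℝ≥0∞} [hp : Fact (1 ≤ p)] {k : ℕ}

/-- The scalar function `u` on `G^{k+1}` represents the `L^p(G)`-valued function `f` when
`f(x)(y) = u(y x₀, …, y x_k)` for almost all `x` and `y`. This is the form taken by the invariance
of `f` under `G`: formally, `u(z) = f(z)(1)`. -/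
def Represents (f : (Fin (k + 1) → G) → Lp ℝ p μ) (u : (Fin (k + 1) → G) → ℝ) : Prop :=
  ∀ᵐ x ∂powMeasure μ k, f x =ᵐ[μ] fun y => u (y • x)

theorem measurable_smul_tuple : Measurable fun q : (Fin (k + 1) → G) × G => q.2 • q.1 := by
  fun_prop

variable (μ) in
theorem quasiMeasurePreserving_smul_tuple (k : ℕ) :
    Measure.QuasiMeasurePreserving (fun q : (Fin (k + 1) → G) × G => q.2 • q.1)
      ((powMeasure μ k).prod μ) (powMeasure μ k) := by
  refine ⟨measurable_smul_tuple, Measure.AbsolutelyContinuous.mk fun N hN h0 => ?_⟩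
  rw [Measure.map_apply measurable_smul_tuple hN,
    Measure.prod_apply_symm (measurable_smul_tuple hN)]
  refine (lintegral_congr fun y => ?_).trans lintegral_zero
  exact (measure_preimage_smul (powMeasure μ k) y N).trans h0

namespace Represents

variable {f f' : (Fin (k + 1) → G) → Lp ℝ p μ} {u u' : (Fin (k + 1) → G) → ℝ}

theorem congr (h : Represents f u) (hu : u =ᵐ[powMeasure μ k] u') : Represents f u' := by
  filter_upwards [h, Measure.ae_ae_of_ae_prod ((quasiMeasurePreserving_smul_tuple μ k).ae hu)]
    with x h₁ h₂
  exact h₁.trans h₂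

/-- The representing function is unique up to almost everywhere equality, because almost
everywhere equality is invariant under left translation. -/
theorem ae_eq (h : Represents f u) (h' : Represents f u') (hu : Measurable u)
    (hu' : Measurable u') : u =ᵐ[powMeasure μ k] u' := by
  have h₁ : ∀ᵐ x ∂powMeasure μ k, ∀ᵐ y ∂μ, u (y • x) = u' (y • x) := by
    filter_upwards [h, h'] with x hx hx'
    exact hx.symm.trans hx'
  have hm : MeasurableSet {q : (Fin (k + 1) → G) × G | u (q.2 • q.1) = u' (q.2 • q.1)} :=
    measurableSet_eq_fun (hu.comp measurable_smul_tuple) (hu'.comp measurable_smul_tuple)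
  obtain ⟨y, hy⟩ := ((Measure.ae_ae_comm hm).1 h₁).exists
  have := (measurePreserving_smul y⁻¹ (powMeasure μ k)).quasiMeasurePreserving.ae hy
  filter_upwards [this] with z hz
  rwa [smul_inv_smul] at hz

theorem eq_of_continuous (h : Represents f u) (h' : Represents f' u) (hf : Continuous f)
    (hf' : Continuous f') : f = f' := by
  refine (hf.ae_eq_iff_eq (powMeasure μ k) hf').1 ?_
  filter_upwards [h, h'] with x hx hx'
  exact Lp.ext (hx.trans hx'.symm)

theorem add (h : Represents f u) (h' : Represents f' u') :
    Represents (fun x => f x + f' x) (fun z => u z + u' z) := by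
  filter_upwards [h, h'] with x hx hx'
  filter_upwards [hx, hx', Lp.coeFn_add (f x) (f' x)] with y h₁ h₂ h₃
  rw [h₃, Pi.add_apply, h₁, h₂]

theorem smul (c : ℝ) (h : Represents f u) : Represents (fun x => c • f x) (fun z => c • u z) := by
  filter_upwards [h] with x hx
  filter_upwards [hx, Lp.coeFn_smul c (f x)] with y h₁ h₂
  rw [h₂, Pi.smul_apply, h₁]

theorem zero : Represents (fun _ : Fin (k + 1) → G => (0 : Lp ℝ p μ)) fun _ => 0 :=
  Eventually.of_forall fun _ => Lp.coeFn_zero ℝ p μ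

theorem sum {ι : Type*} (s : Finset ι) {f : ι → (Fin (k + 1) → G) → Lp ℝ p μ}
    {u : ι → (Fin (k + 1) → G) → ℝ} (h : ∀ i, Represents (f i) (u i)) :
    Represents (fun x => ∑ i ∈ s, f i x) fun z => ∑ i ∈ s, u i z := by
  classical
  induction s using Finset.induction_on with
  | empty => exact zero
  | insert a s ha ih =>
    simp only [Finset.sum_insert ha]
    exact (h a).add ih

theorem altSum (h : Represents f u) : Represents (LpCoh.altSum f) (LpCoh.altSum u) :=
  sum Finset.univ fun j => smul ((-1 : ℝ) ^ (j : ℕ))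
    ((quasiMeasurePreserving_removeNth μ k j).ae h)

/-- The `p`-norm of the representing function over `Δ_s` is controlled by the values of `f` on a
ball. -/
theorem exists_eLpNorm_le (hp' : p ≠ ∞) (k : ℕ) (s : ℝ) : ∃ C : ℝ≥0,
    ∀ (f : (Fin (k + 1) → G) → Lp ℝ p μ) (u : (Fin (k + 1) → G) → ℝ), Measurable u →
      Represents f u → ∀ M : ℝ≥0, (∀ x ∈ Metric.closedBall 1 (s + 1), ‖f x‖ₑ ≤ M) →
        eLpNorm u p ((powMeasure μ k).restrict (diagNhd G k s)) ≤ C * M := by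
  obtain ⟨C, hC⟩ := exists_le_lintegral_smul μ k (s := s)
  have hp0 : p ≠ 0 := (one_pos.trans_le hp.out).ne'
  have hpr : 0 < p.toReal := ENNReal.toReal_pos hp0 hp'
  set K : Set (Fin (k + 1) → G) := Metric.closedBall 1 (s + 1) with hK
  have hKfin : powMeasure μ k K ≠ ∞ := measure_closedBall_lt_top.ne
  have hKm : MeasurableSet K := Metric.isClosed_closedBall.measurableSet
  refine ⟨(C * (powMeasure μ k K).toNNReal) ^ (1 / p.toReal), fun f u hu h M hM => ?_⟩
  have hm : Measurable fun z => ‖u z‖ₑ ^ p.toReal := hu.enorm.pow_const _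
  rw [eLpNorm_eq_lintegral_rpow_enorm_toReal hp0 hp',
    ENNReal.coe_rpow_of_nonneg _ (by positivity)]
  calc (∫⁻ z in diagNhd G k s, ‖u z‖ₑ ^ p.toReal ∂powMeasure μ k) ^ (1 / p.toReal)
      ≤ (C * ∫⁻ y, ∫⁻ w in K, ‖u (y • w)‖ₑ ^ p.toReal ∂powMeasure μ k ∂μ) ^ (1 / p.toReal) :=
        ENNReal.rpow_le_rpow (hC _ hm) (by positivity)
    _ = (C * ∫⁻ w in K, ∫⁻ y, ‖u (y • w)‖ₑ ^ p.toReal ∂μ ∂powMeasure μ k) ^ (1 / p.toReal) := by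
        have hm' : Measurable fun q : G × (Fin (k + 1) → G) => ‖u (q.1 • q.2)‖ₑ ^ p.toReal :=
          hm.comp (by fun_prop)
        rw [lintegral_lintegral_swap hm'.aemeasurable]
    _ ≤ (C * ∫⁻ w in K, (M : ℝ≥0∞) ^ p.toReal ∂powMeasure μ k) ^ (1 / p.toReal) := by
        refine ENNReal.rpow_le_rpow (mul_le_mul_right ?_ _) (by positivity)
        refine lintegral_mono_ae ?_
        filter_upwards [ae_restrict_of_ae h, ae_restrict_mem hKm] with w hw hwK
        refine le_trans (le_of_eq ?_) (ENNReal.rpow_le_rpow (hM w hwK) hpr.le)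
        rw [Lp.enorm_def, eLpNorm_eq_lintegral_rpow_enorm_toReal hp0 hp', ← ENNReal.rpow_mul,
          one_div_mul_cancel hpr.ne', ENNReal.rpow_one]
        refine lintegral_congr_ae ?_
        filter_upwards [hw] with y hy
        rw [hy]
    _ = ((C * (powMeasure μ k K).toNNReal : ℝ≥0) : ℝ≥0∞) ^ (1 / p.toReal) * M := by
        rw [lintegral_const, Measure.restrict_apply_univ, ENNReal.coe_mul,
          ENNReal.coe_toNNReal hKfin, mul_comm ((M : ℝ≥0∞) ^ p.toReal), ← mul_assoc,
          ENNReal.mul_rpow_of_nonneg _ _ (by positivity), ← ENNReal.rpow_mul,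
          mul_one_div_cancel hpr.ne', ENNReal.rpow_one]

end Represents

/-- A continuous invariant cochain is represented by a measurable function. If `F(x, y)` is a
jointly measurable version of `f(x)(y)`, the invariance gives `F(x, y) = F(c⁻¹ y x, c)` for almost
all `x`, `y`, `c`, and for a generic `c` the function `z ↦ F(c⁻¹ z, c)` represents `f`. -/
theorem exists_represents (f : C(Fin (k + 1) → G, Lp ℝ p μ))
    (hf : f ∈ invariantCochains (rightRegular μ p) k) :
    ∃ u : (Fin (k + 1) → G) → ℝ, Measurable u ∧ Represents f u := by
  obtain ⟨F, hF, hfF⟩ := exists_measurable_uncurry_of_stronglyMeasurable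
    (f.continuous.stronglyMeasurable)
  have hinv : ∀ x (g : G), ∀ᵐ y ∂μ, F (x, y) = F (g⁻¹ • x, y * g) := by
    intro x g
    have e : rightTranslation μ p g (f (g⁻¹ • x)) = f x := DFunLike.congr_fun (hf g) x
    have h₁ := (quasiMeasurePreserving_mul_right' μ g).ae (hfF (g⁻¹ • x))
    have h₂ := rightTranslation_apply μ p g (f (g⁻¹ • x))
    rw [e] at h₂
    filter_upwards [hfF x, h₁, h₂] with y h₃ h₄ h₅
    rw [← h₃, h₅, h₄]
  have hc : ∀ x, ∀ᵐ c ∂μ, ∀ᵐ y ∂μ, F (x, y) = F (c⁻¹ • y • x, c) := by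
    intro x
    have hm₁ : MeasurableSet {q : G × G | F (x, q.2) = F (q.1⁻¹ • x, q.2 * q.1)} :=
      measurableSet_eq_fun (hF.comp (by fun_prop)) (hF.comp (by fun_prop))
    have hm₂ : MeasurableSet {q : G × G | F (x, q.2) = F (q.1⁻¹ • q.2 • x, q.1)} :=
      measurableSet_eq_fun (hF.comp (by fun_prop)) (hF.comp (by fun_prop))
    refine (Measure.ae_ae_comm (μ := μ) (ν := μ) hm₂).2 ?_
    filter_upwards [(Measure.ae_ae_comm (μ := μ) (ν := μ) hm₁).1
      (Eventually.of_forall (hinv x))] with y hy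
    -- the element `g` of the invariance relation is `y⁻¹ c`
    filter_upwards [(measurePreserving_mul_left μ y⁻¹).quasiMeasurePreserving.ae hy] with c h
    rwa [mul_inv_rev, inv_inv, mul_smul, mul_inv_cancel_left] at h
  have hm : MeasurableSet {q : ((Fin (k + 1) → G) × G) × G |
      F (q.1.1, q.2) = F (q.1.2⁻¹ • q.2 • q.1.1, q.1.2)} :=
    measurableSet_eq_fun (hF.comp (by fun_prop)) (hF.comp (by fun_prop))
  have hm' : MeasurableSet {q : (Fin (k + 1) → G) × G |
      ∀ᵐ y ∂μ, F (q.1, y) = F (q.2⁻¹ • y • q.1, q.2)} :=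
    measurable_measure_prodMk_left hm.compl (measurableSet_singleton 0)
  obtain ⟨c, hc'⟩ := ((Measure.ae_ae_comm (μ := powMeasure μ k) (ν := μ) hm').1
    (Eventually.of_forall hc)).exists
  refine ⟨fun z => F (c⁻¹ • z, c), hF.comp (by fun_prop), ?_⟩
  filter_upwards [hc'] with x hx
  exact (hfF x).trans hx

/-- The function representing an invariant continuous cochain belongs to `AS^{k,p}(G)`. -/
theorem exists_represents_asSubmodule (hp' : p ≠ ∞)
    (f : invariantCochains (rightRegular μ p) k) :
    ∃ u : ASpace μ p k, Represents f.1 u.1 := by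
  obtain ⟨u, hu, h⟩ := exists_represents f.1 f.2
  have he := AEEqFun.coeFn_mk u hu.aestronglyMeasurable (μ := powMeasure μ k)
  refine ⟨⟨AEEqFun.mk u hu.aestronglyMeasurable, fun s hs => ?_⟩, h.congr he.symm⟩
  obtain ⟨C, hC⟩ := Represents.exists_eLpNorm_le (μ := μ) hp' k s
  obtain ⟨M, hM⟩ := ((isCompact_closedBall (1 : Fin (k + 1) → G) (s + 1)).image
    f.1.continuous).isBounded.exists_norm_le
  refine (memLp_congr_ae (ae_restrict_of_ae he)).2 ⟨hu.aestronglyMeasurable,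
    (hC f.1 u hu h M.toNNReal fun x hx => ?_).trans_lt (ENNReal.mul_lt_top ENNReal.coe_lt_top
      ENNReal.coe_lt_top)⟩
  rw [← ofReal_norm]
  exact ENNReal.ofReal_le_ofReal (hM _ ⟨x, hx, rfl⟩)

theorem Represents.ext {f : (Fin (k + 1) → G) → Lp ℝ p μ} {u u' : ASpace μ p k}
    (h : Represents f u.1) (h' : Represents f u'.1) : u = u' :=
  Subtype.ext (AEEqFun.ext (h.ae_eq h' u.1.stronglyMeasurable.measurable
    u'.1.stronglyMeasurable.measurable))

variable (μ) in
/-- The linear map `φ` sending an invariant continuous cochain to the function representing it. -/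
noncomputable def representLinearMap (hp' : p ≠ ∞) (k : ℕ) :
    invariantCochains (rightRegular μ p) k →ₗ[ℝ] ASpace μ p k where
  toFun f := (exists_represents_asSubmodule hp' f).choose
  map_add' f f' := by
    refine (exists_represents_asSubmodule hp' (f + f')).choose_spec.ext ?_
    exact ((exists_represents_asSubmodule hp' f).choose_spec.add
      (exists_represents_asSubmodule hp' f').choose_spec).congr (AEEqFun.coeFn_add _ _).symm
  map_smul' c f := by
    refine (exists_represents_asSubmodule hp' (c • f)).choose_spec.ext ?_
    exact ((exists_represents_asSubmodule hp' f).choose_spec.smul c).congr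
      (AEEqFun.coeFn_smul c (exists_represents_asSubmodule hp' f).choose.1).symm

theorem represents_representLinearMap (hp' : p ≠ ∞)
    (f : invariantCochains (rightRegular μ p) k) :
    Represents f.1 (representLinearMap μ hp' k f).1 :=
  (exists_represents_asSubmodule hp' f).choose_spec

variable (μ) in
theorem continuous_representLinearMap (hp' : p ≠ ∞) (k : ℕ) :
    Continuous (representLinearMap μ (p := p) hp' k) := by
  refine continuous_of_continuousAt_zero (representLinearMap μ (p := p) hp' k) ?_
  rw [ContinuousAt, map_zero, (asWithSeminorms μ p k).tendsto_nhds]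
  intro s ε hε
  obtain ⟨C, hC⟩ := Represents.exists_eLpNorm_le (μ := μ) (p := p) hp' k s.1
  obtain ⟨δ, hδ, hδε⟩ : ∃ δ : ℝ≥0, 0 < δ ∧ C * δ < ε := by
    refine ⟨(ε / (C + 1)).toNNReal, Real.toNNReal_pos.2 (by positivity), ?_⟩
    rw [Real.coe_toNNReal _ (by positivity), mul_div_assoc', div_lt_iff₀ (by positivity)]
    nlinarith [C.2]
  have ho : IsOpen {f : C(Fin (k + 1) → G, Lp ℝ p μ) |
      Set.MapsTo f (Metric.closedBall 1 (s.1 + 1)) (Metric.ball 0 δ)} :=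
    ContinuousMap.isOpen_setOfPred_mapsTo (isCompact_closedBall _ _) Metric.isOpen_ball
  have hn := (ho.preimage continuous_subtype_val).mem_nhds
    (show (0 : invariantCochains (rightRegular μ p) k) ∈ _ from fun x _ =>
      Metric.mem_ball_self (by exact_mod_cast hδ))
  filter_upwards [hn] with f hf
  rw [sub_zero]
  refine lt_of_le_of_lt ?_ hδε
  have h := hC f.1 _ (representLinearMap μ hp' k f).1.stronglyMeasurable.measurable
    (represents_representLinearMap hp' f) δ fun x hx => by
      rw [← ofReal_norm, ← ENNReal.ofReal_coe_nnreal]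
      exact ENNReal.ofReal_le_ofReal (mem_ball_zero_iff.1 (hf hx)).le
  have h' := ENNReal.toReal_mono (ENNReal.mul_ne_top ENNReal.coe_ne_top ENNReal.coe_ne_top) h
  rwa [ENNReal.toReal_mul] at h'

variable (μ) in
/-- The continuous linear map `φ` sending an invariant continuous cochain to the function
representing it. -/
noncomputable def represent (hp' : p ≠ ∞) (k : ℕ) :
    invariantCochains (rightRegular μ p) k →L[ℝ] ASpace μ p k where
  toLinearMap := representLinearMap μ hp' k
  cont := continuous_representLinearMap μ hp' k

theorem represents_represent (hp' : p ≠ ∞) (f : invariantCochains (rightRegular μ p) k) :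
    Represents f.1 (represent μ hp' k f).1 :=
  represents_representLinearMap hp' f

theorem represent_eq (hp' : p ≠ ∞) {f : invariantCochains (rightRegular μ p) k}
    {u : ASpace μ p k} (h : Represents f.1 u.1) : represent μ hp' k f = u :=
  (represents_represent hp' f).ext h

/-- As continuous cochains are determined by their values almost everywhere, `φ` is injective: an
identity between continuous cochains can be checked on the representing functions. -/
theorem represent_injective (hp' : p ≠ ∞) :
    Function.Injective (represent μ (p := p) hp' k) := by
  intro f f' h
  have h₁ := represents_represent hp' f
  rw [h] at h₁
  exact Subtype.ext (DFunLike.coe_injective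
    (h₁.eq_of_continuous (represents_represent hp' f') f.1.continuous f'.1.continuous))

variable (μ p) in
/-- The differential of the complex `C^*(G, L^p(G))^G`. -/
noncomputable def invariantD (k : ℕ) : invariantCochains (rightRegular μ p) k →L[ℝ]
    invariantCochains (rightRegular μ p) (k + 1) :=
  (groupLpComplex μ p).d k

theorem represent_d (hp' : p ≠ ∞) (f : invariantCochains (rightRegular μ p) k) :
    represent μ hp' (k + 1) (invariantD μ p k f) = asD μ p k (represent μ hp' k f) :=
  represent_eq hp' ((represents_represent hp' f).altSum.congr (coeFn_asD _).symm)

end Representation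

/-! ### Regularization of asymptotic cochains -/

section Regularization

variable {G : Type u} [Group G] [MetricSpace G] [IsTopologicalGroup G] [ProperSpace G]
  [IsIsometricSMul G G] [MeasurableSpace G] [BorelSpace G] (μ : Measure G) [μ.IsHaarMeasure]
  {p : ℝ≥0∞} [hp : Fact (1 ≤ p)]

/-- The closed ball of radius `r` around `1` in `G^{k+1}`, as a compact space. -/
abbrev TupleBall (G : Type u) [Group G] [MetricSpace G] (k : ℕ) (r : ℝ) : Type u :=
  Metric.closedBall (1 : Fin (k + 1) → G) r

/-- The restriction of the product measure to a ball of `G^{k+1}`. -/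
noncomputable abbrev ballMeasure (k : ℕ) (r : ℝ) : Measure (TupleBall G k r) :=
  (powMeasure μ k).comap Subtype.val

theorem measurableSet_tupleBall (k : ℕ) (r : ℝ) :
    MeasurableSet (Metric.closedBall (1 : Fin (k + 1) → G) r) :=
  Metric.isClosed_closedBall.measurableSet

instance (k : ℕ) (r : ℝ) : IsFiniteMeasure (ballMeasure μ k r) := by
  refine ⟨?_⟩
  rw [comap_subtype_coe_apply (measurableSet_tupleBall k r), Set.image_univ, Subtype.range_coe]
  exact measure_closedBall_lt_top

theorem measurable_smul_tupleBall (k : ℕ) (r : ℝ) :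
    Measurable fun q : G × TupleBall G k r => q.1 • (q.2 : Fin (k + 1) → G) := by
  fun_prop

theorem exists_map_smul_tupleBall_le (k : ℕ) (r : ℝ) : ∃ s : ℝ, 0 < s ∧ ∃ C : ℝ≥0,
    (μ.prod (ballMeasure μ k r)).map (fun q => q.1 • (q.2 : Fin (k + 1) → G)) ≤
      (C : ℝ≥0∞) • (powMeasure μ k).restrict (diagNhd G k s) := by
  obtain ⟨C, hC⟩ := exists_lintegral_smul_le μ k r
  refine ⟨2 * |r| + 1, by positivity, C, ?_⟩
  have h := map_restrict_prod_le (l := μ) (ν := ballMeasure μ k r) (ρ := powMeasure μ k)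
    (measurable_smul_tupleBall k r) (C := C) (fun g hg => ?_) MeasurableSet.univ
    (isClosed_diagNhd k (2 * |r| + 1)).measurableSet fun y _ => Eventually.of_forall fun w i j => ?_
  · rwa [Measure.restrict_univ] at h
  · refine le_trans (le_of_eq ?_) (hC g hg)
    exact lintegral_congr fun y =>
      lintegral_subtype_comap (measurableSet_tupleBall k r) fun w => g (y • w)
  · have hw : ∀ i, dist (w.1 i) 1 ≤ |r| := fun i =>
      ((dist_le_pi_dist w.1 1 i).trans w.2).trans (le_abs_self r)
    change dist (y * w.1 i) (y * w.1 j) ≤ _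
    rw [dist_mul_left]
    linarith [dist_triangle_right (w.1 i) (w.1 j) 1, hw i, hw j]

theorem quasiMeasurePreserving_smul_tupleBall (k : ℕ) (r : ℝ) :
    Measure.QuasiMeasurePreserving (fun q : G × TupleBall G k r => q.1 • (q.2 : Fin (k + 1) → G))
      (μ.prod (ballMeasure μ k r)) (powMeasure μ k) :=
  let ⟨_, _, _, hC⟩ := exists_map_smul_tupleBall_le μ k r
  ⟨measurable_smul_tupleBall k r, (Measure.absolutelyContinuous_of_le_smul hC).trans
    Measure.restrict_le_self.absolutelyContinuous⟩

section Weighted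

variable {k : ℕ} (r : ℝ)

/-- The weighted average `y ↦ ∫ a(w) u(y w₀, …, y w_k) dw` over a ball. -/
noncomputable def ballAvg (u : (Fin (k + 1) → G) → ℝ) (a : C(TupleBall G k r, ℝ)) (y : G) : ℝ :=
  ∫ w, a w * u (y • (w : Fin (k + 1) → G)) ∂ballMeasure μ k r

variable {μ}

theorem stronglyMeasurable_ballAvg {u : (Fin (k + 1) → G) → ℝ} (hu : StronglyMeasurable u)
    (a : C(TupleBall G k r, ℝ)) : StronglyMeasurable (ballAvg μ r u a) :=
  StronglyMeasurable.integral_prod_right'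
    (f := fun q : G × TupleBall G k r => a q.2 * u (q.1 • (q.2 : Fin (k + 1) → G)))
    ((a.continuous.stronglyMeasurable.comp_measurable measurable_snd).mul
      (hu.comp_measurable (measurable_smul_tupleBall k r)))

theorem ae_integrable_ballAvg (hp' : p ≠ ∞) (u : ASpace μ p k) :
    ∀ᵐ y ∂μ, ∀ a : C(TupleBall G k r, ℝ),
      Integrable (fun w => a w * u.1 (y • (w : Fin (k + 1) → G))) (ballMeasure μ k r) := by
  obtain ⟨s, hs, C, hC⟩ := exists_map_smul_tupleBall_le μ k r
  filter_upwards [ae_integrable_comp_of_map_le hp.out hp' (measurable_smul_tupleBall k r) hC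
    (u.2 s hs)] with y hy a
  exact hy.bdd_mul a.continuous.aestronglyMeasurable (Eventually.of_forall a.norm_coe_le_norm)

variable (μ p k) in
theorem exists_eLpNorm_ballAvg_le (hp' : p ≠ ∞) : ∃ s : {s : ℝ // 0 < s}, ∃ C : ℝ≥0,
    ∀ (u : ASpace μ p k) (a : C(TupleBall G k r, ℝ)),
      eLpNorm (ballAvg μ r u.1 a) p μ ≤ C * ‖a‖₊ *
        eLpNorm u.1 p ((powMeasure μ k).restrict (diagNhd G k s)) := by
  obtain ⟨s, hs, C, hC⟩ := exists_map_smul_tupleBall_le μ k r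
  have hpr1 : 1 ≤ p.toReal := by
    rw [← ENNReal.toReal_one]; exact ENNReal.toReal_mono hp' hp.out
  have hfin : ballMeasure μ k r Set.univ ^ (1 - 1 / p.toReal) *
      (C : ℝ≥0∞) ^ (1 / p).toReal ≠ ∞ := by
    refine ENNReal.mul_ne_top (ENNReal.rpow_ne_top_of_nonneg ?_ (measure_ne_top _ _))
      (ENNReal.rpow_ne_top_of_nonneg ENNReal.toReal_nonneg ENNReal.coe_ne_top)
    rw [sub_nonneg, div_le_one (by linarith)]
    exact hpr1
  refine ⟨⟨s, hs⟩, (ballMeasure μ k r Set.univ ^ (1 - 1 / p.toReal) *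
    (C : ℝ≥0∞) ^ (1 / p).toReal).toNNReal, fun u a => ?_⟩
  have ha : ∀ w, ‖a w‖ₑ ≤ ‖a‖₊ := fun w => by
    rw [← ofReal_norm, ← ENNReal.ofReal_coe_nnreal]
    exact ENNReal.ofReal_le_ofReal (a.norm_coe_le_norm w)
  rw [ENNReal.coe_toNNReal hfin, mul_comm _ (‖a‖₊ : ℝ≥0∞)]
  exact eLpNorm_integral_comp_le hp.out hp' (measurable_smul_tupleBall k r) hC ha (u.2 s hs)

theorem memLp_ballAvg (hp' : p ≠ ∞) (u : ASpace μ p k) (a : C(TupleBall G k r, ℝ)) :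
    MemLp (ballAvg μ r u.1 a) p μ := by
  obtain ⟨s, C, hC⟩ := exists_eLpNorm_ballAvg_le μ p k r hp'
  exact ⟨(stronglyMeasurable_ballAvg r u.1.stronglyMeasurable a).aestronglyMeasurable,
    (hC u a).trans_lt (ENNReal.mul_lt_top (ENNReal.mul_lt_top ENNReal.coe_lt_top
      ENNReal.coe_lt_top) (u.2 s s.2).2)⟩

variable (μ p k) in
theorem exists_norm_ballAvg_le (hp' : p ≠ ∞) : ∃ s : {s : ℝ // 0 < s}, ∃ C : ℝ≥0,
    ∀ (u : ASpace μ p k) (a : C(TupleBall G k r, ℝ)),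
      ‖(memLp_ballAvg r hp' u a).toLp‖ ≤ C * asSeminorm μ p k s u * ‖a‖ := by
  obtain ⟨s, C, hC⟩ := exists_eLpNorm_ballAvg_le μ p k r hp'
  refine ⟨s, C, fun u a => ?_⟩
  rw [Lp.norm_toLp]
  have h := ENNReal.toReal_mono (ENNReal.mul_ne_top (ENNReal.mul_ne_top ENNReal.coe_ne_top
    ENNReal.coe_ne_top) (u.2 s s.2).2.ne) (hC u a)
  rw [ENNReal.toReal_mul, ENNReal.toReal_mul] at h
  refine h.trans_eq ?_
  change (C : ℝ) * ‖a‖ * asSeminorm μ p k s u = _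
  ring

theorem ballAvg_add_left (hp' : p ≠ ∞) (u v : ASpace μ p k) (a : C(TupleBall G k r, ℝ)) :
    (memLp_ballAvg r hp' (u + v) a).toLp =
      (memLp_ballAvg r hp' u a).toLp + (memLp_ballAvg r hp' v a).toLp := by
  rw [← MemLp.toLp_add, MemLp.toLp_eq_toLp_iff]
  have hq := quasiMeasurePreserving_smul_tupleBall μ k r
  filter_upwards [ae_integrable_ballAvg r hp' u, ae_integrable_ballAvg r hp' v,
    Measure.ae_ae_of_ae_prod (hq.ae (AEEqFun.coeFn_add u.1 v.1))] with y hu hv h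
  refine Eq.trans (integral_congr_ae ?_) (integral_add (hu a) (hv a))
  filter_upwards [h] with w hw
  refine (congrArg (a w * ·) hw).trans ?_
  rw [Pi.add_apply, mul_add]

theorem ballAvg_smul_left (hp' : p ≠ ∞) (c : ℝ) (u : ASpace μ p k) (a : C(TupleBall G k r, ℝ)) :
    (memLp_ballAvg r hp' (c • u) a).toLp = c • (memLp_ballAvg r hp' u a).toLp := by
  rw [← MemLp.toLp_const_smul, MemLp.toLp_eq_toLp_iff]
  have hq := quasiMeasurePreserving_smul_tupleBall μ k r
  filter_upwards [Measure.ae_ae_of_ae_prod (hq.ae (AEEqFun.coeFn_smul c u.1))] with y h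
  refine Eq.trans (integral_congr_ae ?_) (integral_smul c _)
  filter_upwards [h] with w hw
  refine (congrArg (a w * ·) hw).trans ?_
  rw [Pi.smul_apply, smul_eq_mul, smul_eq_mul]
  ring

theorem ballAvg_add_right (hp' : p ≠ ∞) (u : ASpace μ p k) (a b : C(TupleBall G k r, ℝ)) :
    (memLp_ballAvg r hp' u (a + b)).toLp =
      (memLp_ballAvg r hp' u a).toLp + (memLp_ballAvg r hp' u b).toLp := by
  rw [← MemLp.toLp_add, MemLp.toLp_eq_toLp_iff]
  filter_upwards [ae_integrable_ballAvg r hp' u] with y hu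
  refine Eq.trans (integral_congr_ae (Eventually.of_forall fun w => ?_))
    (integral_add (hu a) (hu b))
  exact add_mul _ _ _

theorem ballAvg_smul_right (hp' : p ≠ ∞) (c : ℝ) (u : ASpace μ p k) (a : C(TupleBall G k r, ℝ)) :
    (memLp_ballAvg r hp' u (c • a)).toLp = c • (memLp_ballAvg r hp' u a).toLp := by
  rw [← MemLp.toLp_const_smul, MemLp.toLp_eq_toLp_iff]
  refine Eventually.of_forall fun y => ?_
  refine Eq.trans (integral_congr_ae (Eventually.of_forall fun w => ?_)) (integral_smul c _)
  exact mul_assoc _ _ _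

/-- For `u` in `AS^{k,p}(G)`, the map sending a continuous weight `a` on a ball to the average
`y ↦ ∫ a(w) u(y w₀, …, y w_k) dw` in `L^p(G)`. -/
noncomputable def ballAvgRight (hp' : p ≠ ∞) (u : ASpace μ p k) :
    C(TupleBall G k r, ℝ) →L[ℝ] Lp ℝ p μ :=
  LinearMap.mkContinuousOfExistsBound
    { toFun := fun a => (memLp_ballAvg r hp' u a).toLp
      map_add' := ballAvg_add_right r hp' u
      map_smul' := fun c a => ballAvg_smul_right r hp' c u a } (by
      obtain ⟨s, C, hC⟩ := exists_norm_ballAvg_le μ p k r hp'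
      exact ⟨C * asSeminorm μ p k s u, hC u⟩)

variable (μ) in
/-- The weighted averages over a ball, as a linear map in the cochain `u` with values in the
continuous linear maps in the weight. -/
noncomputable def ballAvgLinearMap (hp' : p ≠ ∞) :
    ASpace μ p k →ₗ[ℝ] (C(TupleBall G k r, ℝ) →L[ℝ] Lp ℝ p μ) where
  toFun u := ballAvgRight r hp' u
  map_add' u v := ContinuousLinearMap.ext (ballAvg_add_left r hp' u v)
  map_smul' c u := ContinuousLinearMap.ext (ballAvg_smul_left r hp' c u)

variable (μ) in
/-- The weighted averages over a ball, as a continuous linear map in the cochain `u` with values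
in the continuous linear maps in the weight. -/
noncomputable def ballAvgCLM (hp' : p ≠ ∞) :
    ASpace μ p k →L[ℝ] (C(TupleBall G k r, ℝ) →L[ℝ] Lp ℝ p μ) where
  toLinearMap := ballAvgLinearMap μ r hp'
  cont := by
    obtain ⟨s, C, hC⟩ := exists_norm_ballAvg_le μ p k r hp'
    refine WithSeminorms.continuous_normedSpace_rng (τ₁₂ := RingHom.id ℝ)
      (C(TupleBall G k r, ℝ) →L[ℝ] Lp ℝ p μ) (asWithSeminorms μ p k) (ballAvgLinearMap μ r hp')
      ⟨{s}, C, fun u => ?_⟩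
    rw [Finset.sup_singleton]
    exact ContinuousLinearMap.opNorm_le_bound _
      (mul_nonneg C.2 (apply_nonneg (asSeminorm μ p k s) u)) (hC u)

theorem ballAvgCLM_apply (hp' : p ≠ ∞) (u : ASpace μ p k) (a : C(TupleBall G k r, ℝ)) :
    ballAvgCLM μ r hp' u a =ᵐ[μ] ballAvg μ r u.1 a :=
  MemLp.coeFn_toLp (memLp_ballAvg r hp' u a)

variable (μ k) in
/-- The kernel `(x, w) ↦ ∏ᵢ χ(xᵢ⁻¹ wᵢ)` of the regularization, as a continuous family of
continuous functions of `w` in a ball. -/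
noncomputable def bumpKernel : C(Fin (k + 1) → G, C(TupleBall G k r, ℝ)) :=
  ContinuousMap.curry ⟨fun q => ∏ i, bump μ ((q.1 i)⁻¹ * (q.2 : Fin (k + 1) → G) i), by
    refine continuous_finsetProd _ fun i _ => (continuous_bump μ).comp ?_
    exact ((continuous_apply i).comp continuous_fst).inv.mul
      ((continuous_apply i).comp (continuous_subtype_val.comp continuous_snd))⟩

/-- The substitution `w = x t`, which moves the dependence on `x` between the cochain and the
kernel. The ball has to contain the support of the kernel. -/
theorem ballAvg_bumpKernel (u : (Fin (k + 1) → G) → ℝ) {x : Fin (k + 1) → G}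
    (hx : dist x 1 + 1 ≤ r) (y : G) :
    ballAvg μ r u (bumpKernel μ k r x) y = ∫ t, u (y • (x * t)) ∂bumpPow μ (k + 1) := by
  have hm : Measurable fun t : Fin (k + 1) → G => ENNReal.ofReal (∏ i, bump μ (t i)) :=
    (Finset.measurable_prod _ fun i _ =>
      (continuous_bump μ).measurable.comp (measurable_pi_apply i)).ennreal_ofReal
  have hnn : ∀ t : Fin (k + 1) → G, 0 ≤ ∏ i, bump μ (t i) := fun t =>
    Finset.prod_nonneg fun i _ => bump_nonneg μ _
  calc ballAvg μ r u (bumpKernel μ k r x) y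
      = ∫ w in Metric.closedBall (1 : Fin (k + 1) → G) r,
          (∏ i, bump μ ((x i)⁻¹ * w i)) * u (y • w) ∂powMeasure μ k :=
        integral_subtype_comap (measurableSet_tupleBall k r)
          fun w : Fin (k + 1) → G => (∏ i, bump μ ((x i)⁻¹ * w i)) * u (y • w)
    _ = ∫ w, (∏ i, bump μ ((x i)⁻¹ * w i)) * u (y • w) ∂powMeasure μ k := by
        refine setIntegral_eq_integral_of_forall_compl_eq_zero fun w hw => ?_
        rw [Metric.mem_closedBall, not_le] at hw
        have h₁ : 1 < dist w x := by linarith [dist_triangle w x 1]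
        obtain ⟨i, hi⟩ : ∃ i, 1 < dist (w i) (x i) := by
          by_contra! h
          exact h₁.not_ge ((dist_pi_le_iff zero_le_one).2 h)
        have h₂ : bump μ ((x i)⁻¹ * w i) = 0 :=
          bump_eq_zero μ (by rw [dist_inv_mul_one]; exact hi.le)
        rw [Finset.prod_eq_zero (Finset.mem_univ i) h₂, zero_mul]
    _ = ∫ t, (∏ i, bump μ (t i)) * u (y • (x * t)) ∂powMeasure μ k := by
        rw [← integral_mul_left_eq_self _ x]
        simp only [Pi.mul_apply, inv_mul_cancel_left]
    _ = ∫ t, u (y • (x * t)) ∂bumpPow μ (k + 1) := by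
        rw [bumpPow_eq_withDensity, integral_withDensity_eq_integral_toReal_smul hm
          (Eventually.of_forall fun _ => ENNReal.ofReal_lt_top)]
        simp only [ENNReal.toReal_ofReal (hnn _), smul_eq_mul]

end Weighted

variable {k : ℕ}

/-- The value at `x` of the regularization of an asymptotic cochain `u`: the element
`y ↦ ∫ u(y x₀ t₀, …, y x_k t_k) dt` of `L^p(G)`. The radius `d(x, 1) + 1` may be replaced by any
larger one (`regularizeAt_eq`). -/
noncomputable def regularizeAt (hp' : p ≠ ∞) (u : ASpace μ p k) (x : Fin (k + 1) → G) : Lp ℝ p μ :=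
  ballAvgCLM μ (dist x 1 + 1) hp' u (bumpKernel μ k (dist x 1 + 1) x)

variable {μ}

theorem coeFn_regularizeAt (hp' : p ≠ ∞) (u : ASpace μ p k) (x : Fin (k + 1) → G) :
    regularizeAt μ hp' u x =ᵐ[μ] fun y => ∫ t, u.1 (y • (x * t)) ∂bumpPow μ (k + 1) := by
  filter_upwards [ballAvgCLM_apply (dist x 1 + 1) hp' u (bumpKernel μ k (dist x 1 + 1) x)]
    with y hy
  exact hy.trans (ballAvg_bumpKernel _ u.1 le_rfl y)

theorem regularizeAt_eq (hp' : p ≠ ∞) (u : ASpace μ p k) {x : Fin (k + 1) → G} {r : ℝ}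
    (hx : dist x 1 + 1 ≤ r) :
    regularizeAt μ hp' u x = ballAvgCLM μ r hp' u (bumpKernel μ k r x) := by
  refine Lp.ext ?_
  filter_upwards [coeFn_regularizeAt hp' u x, ballAvgCLM_apply r hp' u (bumpKernel μ k r x)]
    with y h₁ h₂
  rw [h₁, h₂, ballAvg_bumpKernel r u.1 hx y]

variable (μ) in
theorem continuous_regularizeAt (hp' : p ≠ ∞) (k : ℕ) :
    Continuous fun q : ASpace μ p k × (Fin (k + 1) → G) => regularizeAt μ hp' q.1 q.2 := by
  refine continuous_iff_continuousAt.2 fun q₀ => ?_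
  set r := dist q₀.2 1 + 2 with hr
  have hc : Continuous fun q : ASpace μ p k × (Fin (k + 1) → G) =>
      ballAvgCLM μ r hp' q.1 (bumpKernel μ k r q.2) :=
    ((ballAvgCLM μ r hp').continuous.comp continuous_fst).clm_apply
      ((bumpKernel μ k r).continuous.comp continuous_snd)
  refine hc.continuousAt.congr ?_
  have ho : ∀ᶠ q : ASpace μ p k × (Fin (k + 1) → G) in 𝓝 q₀, dist q.2 1 + 1 < r :=
    (show Continuous fun q : ASpace μ p k × (Fin (k + 1) → G) => dist q.2 1 + 1 by
      fun_prop).continuousAt.eventually_lt continuousAt_const (by linarith)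
  filter_upwards [ho] with q hq
  exact (regularizeAt_eq hp' q.1 hq.le).symm

theorem rightTranslation_regularizeAt (hp' : p ≠ ∞) (u : ASpace μ p k) (g : G)
    (x : Fin (k + 1) → G) :
    rightTranslation μ p g (regularizeAt μ hp' u (g⁻¹ • x)) = regularizeAt μ hp' u x := by
  refine Lp.ext ?_
  filter_upwards [rightTranslation_apply μ p g (regularizeAt μ hp' u (g⁻¹ • x)),
    (quasiMeasurePreserving_mul_right' μ g).ae (coeFn_regularizeAt hp' u (g⁻¹ • x)),
    coeFn_regularizeAt hp' u x] with y h₁ h₂ h₃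
  rw [h₁, h₂, h₃]
  refine integral_congr_ae (Eventually.of_forall fun t => congrArg u.1 ?_)
  rw [← smul_mul_assoc, mul_smul, smul_inv_smul, smul_mul_assoc]

/-- The regularization `(ψ u)(x)(y) = ∫ u(y x₀ t₀, …, y x_k t_k) dt` of an asymptotic cochain, as
a continuous cochain. -/
noncomputable def regularizeCochain (hp' : p ≠ ∞) (u : ASpace μ p k) :
    C(Fin (k + 1) → G, Lp ℝ p μ) where
  toFun := regularizeAt μ hp' u
  continuous_toFun :=
    Continuous.uncurry_left (f := regularizeAt μ hp' (k := k)) u (continuous_regularizeAt μ hp' k)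

theorem regularizeCochain_mem (hp' : p ≠ ∞) (u : ASpace μ p k) :
    regularizeCochain hp' u ∈ invariantCochains (rightRegular μ p) k := by
  intro g
  ext1 x
  exact rightTranslation_regularizeAt hp' u g x

variable (μ) in
/-- The regularization `ψ` as a continuous linear map. -/
noncomputable def regularize (hp' : p ≠ ∞) (k : ℕ) :
    ASpace μ p k →L[ℝ] invariantCochains (rightRegular μ p) k where
  toFun u := ⟨regularizeCochain hp' u, regularizeCochain_mem hp' u⟩
  map_add' u v := Subtype.ext <| ContinuousMap.ext fun x =>
    congrArg (fun L => L (bumpKernel μ k (dist x 1 + 1) x)) (map_add (ballAvgCLM μ _ hp') u v)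
  map_smul' c u := Subtype.ext <| ContinuousMap.ext fun x =>
    congrArg (fun L => L (bumpKernel μ k (dist x 1 + 1) x)) (map_smul (ballAvgCLM μ _ hp') c u)
  cont := Continuous.subtype_mk
    (ContinuousMap.continuous_of_continuous_uncurry _ (continuous_regularizeAt μ hp' k)) _

theorem represent_regularize (hp' : p ≠ ∞) (u : ASpace μ p k) :
    represent μ hp' k (regularize μ hp' k u) = asReg μ hp' k u := by
  refine represent_eq hp' (Represents.congr (Eventually.of_forall fun x => ?_)
    ((admissible_mul μ k).coeFn_avg hp' u).symm)
  filter_upwards [coeFn_regularizeAt hp' u x] with y hy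
  refine hy.trans (integral_congr_ae (Eventually.of_forall fun t => congrArg u.1 ?_))
  exact (smul_mul_assoc y x t).symm

end Regularization

/-! ### The homotopy on continuous cochains -/

section ContinuousHomotopy

variable {G : Type u} [Group G] [MetricSpace G] [IsTopologicalGroup G] [ProperSpace G]
  [IsIsometricSMul G G] [MeasurableSpace G] [BorelSpace G] (μ : Measure G) [μ.IsHaarMeasure]

theorem integrable_bumpPow {V : Type*} [NormedAddCommGroup V] {n : ℕ} {g : (Fin n → G) → V}
    (hg : Continuous g) : Integrable g (bumpPow μ n) := by
  have h : ∀ᵐ t ∂bumpPow μ n, t ∈ Metric.closedBall (1 : Fin n → G) 1 := by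
    filter_upwards [ae_bumpPow μ n] with t ht
    exact (dist_pi_le_iff zero_le_one).2 ht
  rw [← Measure.restrict_eq_self_of_ae_mem h]
  exact hg.continuousOn.integrableOn_compact (isCompact_closedBall _ _)

/-- Integration against the averaging measure, as a linear map on the space of continuous
functions. -/
noncomputable def bumpIntegralLinearMap (V : Type*) [NormedAddCommGroup V] [NormedSpace ℝ V]
    (n : ℕ) : C(Fin n → G, V) →ₗ[ℝ] V where
  toFun f := ∫ t, f t ∂bumpPow μ n
  map_add' f g := integral_add (integrable_bumpPow μ f.continuous)
    (integrable_bumpPow μ g.continuous)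
  map_smul' c f := integral_smul c f

/-- Integration against the averaging measure, as a continuous linear map on the space of
continuous functions with the compact-open topology. -/
noncomputable def bumpIntegral (V : Type*) [NormedAddCommGroup V] [NormedSpace ℝ V] (n : ℕ) :
    C(Fin n → G, V) →L[ℝ] V where
  toLinearMap := bumpIntegralLinearMap μ V n
  cont := by
    refine continuous_of_continuousAt_zero (bumpIntegralLinearMap μ V n) ?_
    rw [ContinuousAt, map_zero, Metric.tendsto_nhds]
    intro ε hε
    have ho : IsOpen {f : C(Fin n → G, V) |
        Set.MapsTo f (Metric.closedBall 1 1) (Metric.ball 0 (ε / 2))} :=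
      ContinuousMap.isOpen_setOfPred_mapsTo (isCompact_closedBall _ _) Metric.isOpen_ball
    filter_upwards [ho.mem_nhds fun x _ => Metric.mem_ball_self (by positivity)] with f hf
    rw [dist_zero_right]
    refine lt_of_le_of_lt (norm_integral_le_of_norm_le_const (C := ε / 2) ?_) ?_
    · filter_upwards [ae_bumpPow μ n] with t ht
      exact (mem_ball_zero_iff.1 (hf ((dist_pi_le_iff zero_le_one).2 ht))).le
    · rw [measureReal_def, measure_univ, ENNReal.toReal_one, mul_one]
      linarith

/-- The operator `f ↦ (x ↦ ∫ f(c(x, t)) dt)` on continuous functions. -/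
noncomputable def cochainAvg {X Y V : Type*} [TopologicalSpace X] [LocallyCompactSpace X]
    [TopologicalSpace Y] [NormedAddCommGroup V] [NormedSpace ℝ V] {n : ℕ}
    (c : C(X × (Fin n → G), Y)) : C(Y, V) →L[ℝ] C(X, V) where
  toFun f := ContinuousMap.comp ⟨bumpIntegral μ V n, (bumpIntegral μ V n).continuous⟩
    (f.comp c).curry
  map_add' f g := ContinuousMap.ext fun x =>
    map_add (bumpIntegral μ V n) ((f.comp c).curry x) ((g.comp c).curry x)
  map_smul' a f := ContinuousMap.ext fun x =>
    map_smul (bumpIntegral μ V n) a ((f.comp c).curry x)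
  cont := (ContinuousMap.continuous_postcomp _).comp
    (ContinuousMap.continuous_curry.comp (ContinuousMap.continuous_precomp c))

variable {p : ℝ≥0∞} [hp : Fact (1 ≤ p)] {k l n : ℕ}

theorem cochainAvg_mem_invariantCochains
    {c : C((Fin (k + 1) → G) × (Fin n → G), Fin (l + 1) → G)}
    (hc : ∀ (g : G) x t, c (g • x, t) = g • c (x, t)) {f : C(Fin (l + 1) → G, Lp ℝ p μ)}
    (hf : f ∈ invariantCochains (rightRegular μ p) l) :
    cochainAvg μ c f ∈ invariantCochains (rightRegular μ p) k := by
  intro g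
  ext1 x
  change rightTranslation μ p g (∫ t, f (c (g⁻¹ • x, t)) ∂bumpPow μ n) =
    ∫ t, f (c (x, t)) ∂bumpPow μ n
  have hi : Integrable (fun t => f (c (g⁻¹ • x, t))) (bumpPow μ n) :=
    integrable_bumpPow μ (by fun_prop)
  rw [← ContinuousLinearMap.integral_comp_comm _ hi]
  refine integral_congr_ae (Eventually.of_forall fun t => ?_)
  have := DFunLike.congr_fun (hf g) (c (x, t))
  refine Eq.trans ?_ this
  change _ = rightTranslation μ p g (f (g⁻¹ • c (x, t)))
  rw [← hc]

/-- The operator `f ↦ (x ↦ ∫ f(c(x, t)) dt)` on invariant cochains, for an equivariant `c`. -/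
noncomputable def invariantAvg (c : C((Fin (k + 1) → G) × (Fin n → G), Fin (l + 1) → G))
    (hc : ∀ (g : G) x t, c (g • x, t) = g • c (x, t)) :
    invariantCochains (rightRegular μ p) l →L[ℝ] invariantCochains (rightRegular μ p) k :=
  ((cochainAvg μ c).comp (invariantCochains (rightRegular μ p) l).subtypeL).codRestrict _
    fun f => cochainAvg_mem_invariantCochains μ hc f.2

/-- Averaging commutes with passing to the representing functions. -/
theorem represent_invariantAvg (hp' : p ≠ ∞)
    (c : C((Fin (k + 1) → G) × (Fin n → G), Fin (l + 1) → G))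
    (hc : ∀ (g : G) x t, c (g • x, t) = g • c (x, t)) (hm : Admissible μ c)
    (f : invariantCochains (rightRegular μ p) l) :
    represent μ hp' k (invariantAvg μ c hc f) = hm.avg hp' (represent μ hp' l f) := by
  set u := represent μ hp' l f
  refine represent_eq hp' (Represents.congr (u := fun z => ∫ t, u.1 (c (z, t)) ∂bumpPow μ n) ?_
    (hm.coeFn_avg hp' u).symm)
  filter_upwards [Measure.ae_ae_of_ae_prod
    (hm.quasiMeasurePreserving.ae (represents_represent hp' f))] with x hx
  have hi : Integrable (fun t => f.1 (c (x, t))) (bumpPow μ n) :=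
    integrable_bumpPow μ (by fun_prop)
  have hH : StronglyMeasurable fun q : (Fin n → G) × G => u.1 (q.2 • c (x, q.1)) :=
    u.1.stronglyMeasurable.comp_measurable (by fun_prop)
  filter_upwards [coeFn_integral_Lp hi hH hx] with y hy
  refine hy.trans (integral_congr_ae (Eventually.of_forall fun t => congrArg u.1 ?_))
  exact (hc y x t).symm

variable (G) in
/-- The map `(x, t) ↦ (x₀, …, xᵢ, xᵢ tᵢ, …, x_k t_k)`. -/
def prismMap (k : ℕ) (i : Fin (k + 1)) :
    C((Fin (k + 1) → G) × (Fin (k + 1) → G), Fin (k + 2) → G) where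
  toFun q := prism i q.1 (q.1 * q.2)
  continuous_toFun := by
    refine continuous_pi fun j => ?_
    unfold prism
    split_ifs <;> fun_prop

theorem prismMap_smul (k : ℕ) (i : Fin (k + 1)) (g : G) (x t : Fin (k + 1) → G) :
    prismMap G k i (g • x, t) = g • prismMap G k i (x, t) := by
  ext j
  simp only [prismMap, ContinuousMap.coe_mk, prism, Pi.smul_apply, smul_mul_assoc]
  split_ifs <;> rfl

/-- The homotopy
`(α f)(x) = -∑ᵢ (-1)ⁱ ∫ f(x₀, …, xᵢ, xᵢ tᵢ, …, x_k t_k) dt` on invariant continuous cochains. -/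
noncomputable def cochainHtpy (k : ℕ) :
    invariantCochains (rightRegular μ p) (k + 1) →L[ℝ] invariantCochains (rightRegular μ p) k :=
  -∑ i : Fin (k + 1), (-1 : ℝ) ^ (i : ℕ) •
    invariantAvg μ (p := p) (prismMap G k i) (prismMap_smul k i)

theorem represent_cochainHtpy (hp' : p ≠ ∞) (f : invariantCochains (rightRegular μ p) (k + 1)) :
    represent μ hp' k (cochainHtpy μ k f) = asHtpy μ hp' k (represent μ hp' (k + 1) f) := by
  have h := fun i => represent_invariantAvg μ hp' (prismMap G k i) (prismMap_smul k i)
    (admissible_prism μ k i) f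
  simp only [cochainHtpy, asHtpy, neg_apply, sum_apply, smul_apply, map_neg, map_sum, map_smul, h]
  rfl

theorem regularize_asD (hp' : p ≠ ∞) (u : ASpace μ p k) :
    regularize μ hp' (k + 1) (asD μ p k u) = invariantD μ p k (regularize μ hp' k u) :=
  represent_injective hp' <| by
    rw [represent_d, represent_regularize, represent_regularize, asReg_asD]

theorem cochainHtpy_zero (hp' : p ≠ ∞) (f : invariantCochains (rightRegular μ p) 0) :
    cochainHtpy μ 0 (invariantD μ p 0 f) = f - regularize μ hp' 0 (represent μ hp' 0 f) :=
  represent_injective hp' <| by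
    rw [represent_cochainHtpy, represent_d, asHtpy_zero, map_sub, represent_regularize]

theorem cochainHtpy_succ (hp' : p ≠ ∞) (f : invariantCochains (rightRegular μ p) (k + 1)) :
    invariantD μ p k (cochainHtpy μ k f) + cochainHtpy μ (k + 1) (invariantD μ p (k + 1) f) =
      f - regularize μ hp' (k + 1) (represent μ hp' (k + 1) f) :=
  represent_injective hp' <| by
    rw [map_add, represent_cochainHtpy, represent_d, represent_d, represent_cochainHtpy,
      asHtpy_succ, map_sub, represent_regularize]

/-- The homotopy equivalence between the complex of invariant continuous cochains and the
asymptotic complex. -/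
noncomputable def htpyEquiv (hp' : p ≠ ∞) :
    TopComplex.HtpyEquiv (groupLpComplex μ p) (asymptoticComplex μ p) where
  φ := represent μ hp'
  ψ := regularize μ hp'
  α := cochainHtpy μ
  β := asHtpy μ hp'
  φ_d _ f := represent_d hp' f
  ψ_d _ u := regularize_asD μ hp' u
  α_zero f := cochainHtpy_zero μ hp' f
  α_succ _ f := cochainHtpy_succ μ hp' f
  β_zero u := (asHtpy_zero hp' u).trans (congrArg (u - ·) (represent_regularize hp' u).symm)
  β_succ k u := (asHtpy_succ hp' k u).trans (congrArg (u - ·) (represent_regularize hp' u).symm)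

end ContinuousHomotopy

end LpCoh

theorem mainTheorem2 {G : Type*} [Group G] [MetricSpace G] [IsTopologicalGroup G]
    [ProperSpace G] [IsIsometricSMul G G] [MeasurableSpace G] [BorelSpace G]
    (μ : MeasureTheory.Measure G) [μ.IsHaarMeasure]
    (p : ENNReal) [Fact (1 ≤ p)] (hp : 1 < p) (hp_top : p ≠ ⊤) :
    Nonempty (LpCoh.TopComplex.HtpyEquiv (LpCoh.groupLpComplex μ p)
      (LpCoh.asymptoticComplex μ p)) ∧
    (∀ k : ℕ, Nonempty ((LpCoh.groupLpComplex μ p).cohomology k ≃L[ℝ]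
      (LpCoh.asymptoticComplex μ p).cohomology k)) ∧
    (∀ k : ℕ, Nonempty ((LpCoh.groupLpComplex μ p).reducedCohomology k ≃L[ℝ]
      (LpCoh.asymptoticComplex μ p).reducedCohomology k)) := by
  let e := LpCoh.htpyEquiv μ hp_top
  exact ⟨⟨e⟩, fun k => ⟨e.cohomologyEquiv k⟩, fun k => ⟨e.reducedCohomologyEquiv k⟩⟩
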